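/- Let $V$ be a real vector space of finite dimension $d$ with a lattice $\Lambda$, and let $\mathfrak c\subset V$ be a full-dimensional rational polyhedral cone with vertex $0$, i.e. a cone generated by finitely many vectors of $\Lambda$ that spans $V$. *Functions of $\xi$.* Let $\mathcal M_\ell(V^*)$ be the ring of meromorphic functions near $0\in V^*_{\mathbb C}$ of the form $\phi(\xi)/\prod_{j=1}^N\langle\xi,w_j\rangle$ with $\phi$ holomorphic near $0$ and $0\ne w_j\in V$. For $m\in\mathbb Z$ let $\mathcal R_{[m]}(V^*)$ be the set of rational functions $P(\xi)/\prod_{j=1}^N\langle\xi,w_j\rangle$ with $P$ a homogeneous polynomial of degree $m+N$ and $0\neq w_j\in V$. The homogeneous component $\phi_{[m]}$ of $\phi\in\mathcal M_\ell(V^*)$ is defined by the Laurent expansion $\phi(\tau\xi)=\sum_{m\ge m_0}\tau^m\phi_{[m]}(\xi)$ in $\tau\in\mathbb C$. *Generating functions.* For a shifted cone $\mathfrak p=s+\mathfrak c$ without lines, let $S(\mathfrak p)$ and $I(\mathfrak p)$ be the elements of $\mathcal M_\ell(V^*)$ that continue $\xi\mapsto\sum_{x\in\mathfrak p\cap\Lambda}e^{\langle\xi,x\rangle}$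 and $\xi\mapsto\int_{\mathfrak p}e^{\langle\xi,x\rangle}\,dx$ from their domains of convergence, where $dx$ is the Lebesgue measure for which $V/\Lambda$ has measure $1$; if $\mathfrak p$ contains a line, $S(\mathfrak p)=I(\mathfrak p)=0$. Put $M(s,\mathfrak c)(\xi)=e^{-\langle\xi,s\rangle}S(s+\mathfrak c)(\xi)$. *Functions of $s$.* Let $\{t\}\in[0,1)$ denote the fractional part of $t\in\mathbb R$. For a finite set $\Psi$ of linear forms on $V$, let $\mathcal Q^\Psi_{[\le k]}(V)$ be the space of functions on $V$ spanned by the products of at most $k$ functions $s\mapsto\{\langle\eta,s\rangle\}$ with $\eta\in\Psi$ (so it is $0$ if $k<0$). Let $\mathcal{QP}^\Psi_{[\le q]}(V)$ (quasi-polynomials of local degree at most $q$) be the space spanned by the products $f\,p$ with $f\in\mathcal Q^\Psi_{[\le k]}(V)$, $p$ a homogeneous polynomial of degree $r$ on $V$, and $k+r\le q$. For a space $A$ of functions on $V$, $A\otimes\mathcal R_{[m]}(V^*)$ denotes the finite sums of functions $(s,\xi)\mapsto f(s)g(\xi)$ with $f\in A$, $g\in\mathcal R_{[m]}(V^*)$.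 *The set $\Psi_{\mathfrak c}$.* Consider a decomposition of indicator functions $[\mathfrak c]\equiv\sum_{\mathfrak u}\epsilon_{\mathfrak u}[\mathfrak u]$, $\epsilon_{\mathfrak u}=\pm1$, modulo the span of the indicator functions of rational cones that contain lines, where each $\mathfrak u$ is the unimodular cone generated by a basis $v^{\mathfrak u}_1,\dots,v^{\mathfrak u}_d$ of $\Lambda$, and the sum is finite. Let $\eta^{\mathfrak u}_1,\dots,\eta^{\mathfrak u}_d$ be the dual basis, and let $\Psi_{\mathfrak c}$ be the set of all $-\eta^{\mathfrak u}_j$. **Theorem.** 1. For every such decomposition and every $m\in\mathbb Z$, the function $(s,\xi)\mapsto M(s,\mathfrak c)_{[m]}(\xi)$ belongs to $\mathcal Q^{\Psi_{\mathfrak c}}_{[\le m+d]}(V)\otimes\mathcal R_{[m]}(V^*)$. 2. For every such decomposition and every $m\in\mathbb Z$, the function $(s,\xi)\mapsto S(s+\mathfrak c)_{[m]}(\xi)$ belongs to $\mathcal{QP}^{\Psi_{\mathfrak c}}_{[\le m+d]}(V)\otimes\mathcal R_{[m]}(V^*)$. More precisely, for all $m\in\mathbb Z$ and $s\in V$ (the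 sum being empty if $m<-d$), $$S(s+\mathfrak c)_{[m]}(\xi)=\sum_{r=0}^{m+d}\frac{\langle\xi,s\rangle^r}{r!}\,M(s,\mathfrak c)_{[m-r]}(\xi).$$ 3. For every $s\in V$, $S(s+\mathfrak c)_{[m]}=M(s,\mathfrak c)_{[m]}=0$ for $m<-d$, and $$S(s+\mathfrak c)_{[-d]}(\xi)=M(s,\mathfrak c)_{[-d]}(\xi)=I(\mathfrak c)(\xi),$$ which does not depend on $s$ and is nonzero if $\mathfrak c$ contains no line. Thus for such $\mathfrak c$ the component of lowest degree has degree exactly $-d$. -/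

import Mathlib

open scoped Pointwise Topology

noncomputable section

namespace ConeSums

open Filter MeasureTheory

/-- The complexified dual space `V*_ℂ`: real-linear forms on `V` with complex values (all of them
continuous, as `V` will be finite-dimensional). -/
abbrev CDual (V : Type*) [NormedAddCommGroup V] [NormedSpace ℝ V] := V →L[ℝ] ℂ

section Meromorphic

variable (V : Type*) [NormedAddCommGroup V] [NormedSpace ℝ V]

/-- The filter of neighbourhoods of `0` in `V*_ℂ` from which finitely many hyperplanes
`⟨ξ, w⟩ = 0`, with `0 ≠ w ∈ V`, are removed. -/
def nearZero : Filter (CDual V) :=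
  𝓝 0 ⊓ ⨅ w : {w : V // w ≠ 0}, 𝓟 {ξ : CDual V | ξ w.1 ≠ 0}

/-- Germs at `0` of complex functions on `V*_ℂ`, two functions being identified when they agree
near `0` off finitely many hyperplanes `⟨ξ, w⟩ = 0`. A meromorphic function whose poles lie
on finitely many such hyperplanes is determined by its germ. -/
abbrev FGerm := Filter.Germ (nearZero V) ℂ

/-- `𝓜_ℓ(V*)`: quotients `φ(ξ) / ∏ ⟨ξ, w_j⟩` with `φ` holomorphic near `0` and `w_j ∈ V` nonzero. -/
def MeroLin : Set (FGerm V) :=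
  {F | ∃ (N : ℕ) (w : Fin N → V) (φ : CDual V → ℂ), (∀ j, w j ≠ 0) ∧ AnalyticAt ℂ φ 0 ∧
    F = ((fun ξ => φ ξ / ∏ j, ξ (w j) : CDual V → ℂ) : FGerm V)}

/-- Homogeneous polynomial functions of degree `k` on `V*_ℂ`: linear combinations of products of
`k` linear forms `ξ ↦ ⟨ξ, x⟩`. -/
def homPolyDual (k : ℕ) : Submodule ℂ (CDual V → ℂ) :=
  Submodule.span ℂ (Set.range fun x : Fin k → V => fun ξ : CDual V => ∏ i, ξ (x i))

/-- `𝓡_[m](V*)`: rational functions `P(ξ) / ∏_{j=1}^N ⟨ξ, w_j⟩` with `P` a homogeneous polynomial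
of degree `m + N`. -/
def HomRat (m : ℤ) : Set (FGerm V) :=
  {F | ∃ (N k : ℕ) (w : Fin N → V) (P : CDual V → ℂ), (k : ℤ) = m + N ∧ (∀ j, w j ≠ 0) ∧
    P ∈ homPolyDual V k ∧ F = ((fun ξ => P ξ / ∏ j, ξ (w j) : CDual V → ℂ) : FGerm V)}

end Meromorphic

/-- `g` has near `0` the Laurent expansion `g(τ) = ∑_{n ≥ n₀} a n τ^n`. -/
def HasLaurent (g : ℂ → ℂ) (a : ℤ → ℂ) : Prop :=
  (∃ n₀ : ℤ, ∀ n < n₀, a n = 0) ∧ ∀ᶠ τ in 𝓝[≠] (0 : ℂ), HasSum (fun n : ℤ => a n * τ ^ n) (g τ)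

open Classical in
/-- The coefficient of `τ^m` in the Laurent expansion of `g` at `0`. -/
def laurentCoeff (g : ℂ → ℂ) (m : ℤ) : ℂ :=
  if h : ∃ a, HasLaurent g a then h.choose m else 0

theorem laurentCoeff_congr {g₁ g₂ : ℂ → ℂ} (h : g₁ =ᶠ[𝓝[≠] (0 : ℂ)] g₂) (m : ℤ) :
    laurentCoeff g₁ m = laurentCoeff g₂ m := by
  have key : HasLaurent g₁ = HasLaurent g₂ := by
    funext a
    refine propext (and_congr_right fun _ => eventually_congr ?_)
    filter_upwards [h] with τ hτ
    rw [hτ]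
  unfold laurentCoeff
  rw [key]

section Components

variable {V : Type*} [NormedAddCommGroup V] [NormedSpace ℝ V]

theorem eventually_ray {p : CDual V → Prop} (h : ∀ᶠ ξ in nearZero V, p ξ) :
    ∀ᶠ ξ in nearZero V, ∀ᶠ τ in 𝓝[≠] (0 : ℂ), p (τ • ξ) := by
  rw [nearZero, Filter.eventually_inf] at h
  obtain ⟨s, hs, t, ht, hp⟩ := h
  have h3 : ∀ᶠ ξ in ⨅ w : {w : V // w ≠ 0}, 𝓟 {ξ : CDual V | ξ w.1 ≠ 0},
      ∀ τ : ℂ, τ ≠ 0 → τ • ξ ∈ t := by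
    obtain ⟨I, hI, W, hW, hU⟩ := Filter.mem_iInf.mp ht
    obtain ⟨hW, rfl⟩ := hW, hU
    rw [Filter.Eventually, Filter.mem_iInf]
    refine ⟨I, hI, fun i => {ξ : CDual V | ξ i.1.1 ≠ 0} ∪ {ξ | ∀ τ : ℂ, τ ≠ 0 → τ • ξ ∈ ⋂ i, W i},
      fun i => Filter.mem_principal.mpr Set.subset_union_left, ?_⟩
    ext ξ
    simp only [Set.mem_ofPred_eq, Set.mem_iInter, Set.mem_union]
    constructor
    · intro hξ i
      exact Or.inr hξ
    · intro hξ τ hτ i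
      by_cases hc : ∀ τ : ℂ, τ ≠ 0 → ∀ i, τ • ξ ∈ W i
      · exact hc τ hτ i
      · refine Filter.mem_principal.mp (hW i) ?_
        have := (hξ i).resolve_right hc
        simpa [hτ] using this
  have h4 := h3.filter_mono (inf_le_right : nearZero V ≤ _)
  filter_upwards [h4] with ξ hξ
  have hc : Tendsto (fun τ : ℂ => τ • ξ) (𝓝[≠] 0) (𝓝 0) := by
    have : Continuous fun τ : ℂ => τ • ξ := by fun_prop
    have h0 := this.tendsto 0
    rw [show (0 : ℂ) • ξ = 0 from zero_smul ℂ ξ] at h0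
    exact h0.mono_left nhdsWithin_le_nhds
  filter_upwards [hc hs, self_mem_nhdsWithin] with τ h1 h2
  exact hp _ ⟨h1, hξ τ h2⟩

/-- The homogeneous component `F_[m]` of degree `m`, the coefficient of `τ^m` in
`F(τξ) = ∑ τ^m F_[m](ξ)`. -/
def homComp (F : FGerm V) (m : ℤ) : FGerm V :=
  F.liftOn (fun f => ((fun ξ => laurentCoeff (fun τ => f (τ • ξ)) m : CDual V → ℂ) : FGerm V))
    (by
      intro f g hfg
      refine Filter.Germ.coe_eq.mpr ?_
      filter_upwards [eventually_ray hfg] with ξ hξ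
      exact laurentCoeff_congr hξ m)

/-- The element `F` of `𝓜_ℓ(V*)` takes, near `0`, the value `z` at `ξ` whenever `val ξ z` holds. -/
def IsContinuation (val : CDual V → ℂ → Prop) (F : FGerm V) : Prop :=
  F ∈ MeroLin V ∧ ∃ f : CDual V → ℂ, F = (f : FGerm V) ∧
    ∀ᶠ ξ in nearZero V, ∀ z, val ξ z → f ξ = z

open Classical in
/-- The element of `𝓜_ℓ(V*)` which analytically continues a partially defined function. -/
def continuation (val : CDual V → ℂ → Prop) : FGerm V :=
  if h : ∃ F, IsContinuation val F then h.choose else 0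

def ContainsLine (p : Set V) : Prop := ∃ x v : V, v ≠ 0 ∧ ∀ t : ℝ, x + t • v ∈ p

open Classical in
/-- The discrete generating function `S_Λ(p) ∈ 𝓜_ℓ(V*)`, the continuation of
`ξ ↦ ∑_{x ∈ p ∩ Λ} e^⟨ξ,x⟩`, and `0` if `p` contains a line. -/
def genS (Λ : Submodule ℤ V) (p : Set V) : FGerm V :=
  if ContainsLine p then 0
  else continuation fun ξ z => HasSum (fun x : {x : V // x ∈ p ∧ x ∈ Λ} => Complex.exp (ξ x.1)) z

/-- `M_Λ(s, c)(ξ) = e^{-⟨ξ,s⟩} S_Λ(s + c)(ξ)`. -/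
def genM (Λ : Submodule ℤ V) (s : V) (c : PointedCone ℝ V) : FGerm V :=
  ((fun ξ => Complex.exp (-ξ s) : CDual V → ℂ) : FGerm V) * genS Λ (s +ᵥ (c : Set V))

/-- The Lebesgue measure for which `V/Λ` has measure `1`. -/
def latticeMeasure [FiniteDimensional ℝ V] [MeasurableSpace V] [BorelSpace V] (Λ : Submodule ℤ V)
    [DiscreteTopology Λ] [IsZLattice ℝ Λ] : Measure V :=
  haveI := ZLattice.module_free ℝ Λ
  ((Module.Free.chooseBasis ℤ Λ).ofZLatticeBasis ℝ Λ).addHaar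

open Classical in
/-- The continuous generating function `I_Λ(p) ∈ 𝓜_ℓ(V*)`, the continuation of
`ξ ↦ ∫_p e^⟨ξ,x⟩ dx`, and `0` if `p` contains a line. -/
def genI [FiniteDimensional ℝ V] [MeasurableSpace V] [BorelSpace V] (Λ : Submodule ℤ V)
    [DiscreteTopology Λ] [IsZLattice ℝ Λ] (p : Set V) : FGerm V :=
  if ContainsLine p then 0
  else continuation fun ξ z =>
    IntegrableOn (fun x : V => Complex.exp (ξ x)) p (latticeMeasure Λ) ∧
      z = ∫ x in p, Complex.exp (ξ x) ∂(latticeMeasure Λ)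

end Components

section StepPolynomials

variable {V : Type*} [AddCommGroup V] [Module ℝ V]

/-- `𝓠^Ψ_[≤ k](V)`: step-polynomials spanned by products of at most `k` functions
`s ↦ {⟨η, s⟩}`, `η ∈ Ψ` (the zero space if `k < 0`). -/
def stepPoly (Ψ : Set (Module.Dual ℝ V)) (k : ℤ) : Submodule ℝ (V → ℝ) :=
  Submodule.span ℝ {f | ∃ (n : ℕ) (η : Fin n → Module.Dual ℝ V), (n : ℤ) ≤ k ∧ (∀ i, η i ∈ Ψ) ∧
    f = fun s => ∏ i, Int.fract (η i s)}

/-- `𝓟_[r](V)`: homogeneous polynomial functions of degree `r` on `V`. -/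
def homPoly (V : Type*) [AddCommGroup V] [Module ℝ V] (r : ℕ) : Submodule ℝ (V → ℝ) :=
  Submodule.span ℝ (Set.range fun l : Fin r → Module.Dual ℝ V => fun s : V => ∏ i, l i s)

/-- `𝓠𝓟^Ψ_[≤ q](V)`: quasi-polynomials of local degree at most `q`, the sum of the
`𝓠^Ψ_[≤ k](V) ⊗ 𝓟_[r](V)` with `k + r ≤ q`. -/
def quasiPoly (Ψ : Set (Module.Dual ℝ V)) (q : ℤ) : Submodule ℝ (V → ℝ) :=
  Submodule.span ℝ {h | ∃ (k : ℤ) (r : ℕ), k + r ≤ q ∧ ∃ f ∈ stepPoly Ψ k, ∃ p ∈ homPoly V r,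
    h = f * p}

/-- `A ⊗ R` as a space of functions of `(s, ξ)`: finite sums of `f(s) g(ξ)` with `f ∈ A`, `g ∈ R`,
seen as functions of `s` with values in functions of `ξ`. -/
def tensorFun {E : Type*} [AddCommGroup E] [Module ℝ E] (A : Submodule ℝ (V → ℝ)) (R : Set E) :
    Submodule ℝ (V → E) :=
  Submodule.span ℝ {F | ∃ f ∈ A, ∃ g ∈ R, F = fun s => f s • g}

end StepPolynomials

section Cones

variable {V : Type*} [NormedAddCommGroup V] [NormedSpace ℝ V]

/-- Rational polyhedral cones (possibly containing lines): generated by finitely many lattice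
vectors. -/
def IsRationalCone (Λ : Submodule ℤ V) (c : PointedCone ℝ V) : Prop :=
  ∃ T : Finset V, (∀ v ∈ T, v ∈ Λ) ∧ c = PointedCone.hull ℝ (T : Set V)

/-- Full-dimensional cones. -/
def IsFullDim (c : PointedCone ℝ V) : Prop := Submodule.span ℝ (c : Set V) = ⊤

/-- The unimodular full-dimensional cone generated by a basis of the lattice. -/
def unimodularCone {Λ : Submodule ℤ V} {ι : Type*} (b : Module.Basis ι ℤ Λ) : PointedCone ℝ V :=
  PointedCone.hull ℝ (Set.range fun j => (b j : V))

def coneIndicator (c : PointedCone ℝ V) : V → ℝ := (c : Set V).indicator 1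

/-- A decomposition `[c] ≡ ∑_u ε_u [u]` into a signed sum of full-dimensional unimodular cones,
modulo the span of the indicator functions of cones which contain lines. -/
structure UnimodularDecomposition (Λ : Submodule ℤ V) (c : PointedCone ℝ V) where
  n : ℕ
  sign : Fin n → ℤˣ
  basis : Fin n → Module.Basis (Fin (Module.finrank ℝ V)) ℤ Λ
  congr : coneIndicator c - ∑ u, ((sign u : ℤ) : ℝ) • coneIndicator (unimodularCone (basis u)) ∈
    Submodule.span ℝ {f : V → ℝ | ∃ c' : PointedCone ℝ V, IsRationalCone Λ c' ∧
      ContainsLine (c' : Set V) ∧ f = coneIndicator c'}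

/-- The set `Ψ_c` of all linear forms `-η_j^u`, where `(η_j^u)_j` is the dual basis of the basis
`(v_j^u)_j` of `Λ` that generates the cone `u`. -/
def UnimodularDecomposition.Psi [FiniteDimensional ℝ V] {Λ : Submodule ℤ V} [DiscreteTopology Λ]
    [IsZLattice ℝ Λ] {c : PointedCone ℝ V} (D : UnimodularDecomposition Λ c) :
    Set (Module.Dual ℝ V) :=
  {η | ∃ u j, η = -((D.basis u).ofZLatticeBasis ℝ Λ).coord j}

end Cones

end ConeSums

end

open ConeSums

/-!
The generating function of a set of lattice points is obtained algebraically. A function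
`f : V → ℂ` has a generating function when a product of difference operators `f ↦ f - f(· - w)`,
`w ≠ 0`, makes its support finite; the germ is then the exponential sum of the resulting function,
divided by the corresponding product of factors `1 - e^⟨ξ,w⟩` (`HasGen`). The germ does not depend
on the operators (`HasGen.unique`), is additive in `f`, agrees with every convergent sum
(`HasGen.eventually_eq_of_hasSum`), and vanishes if `f` is invariant under a nonzero translation,
which is the case for rational cones containing lines. The lattice points of a shifted rational cone
form a finitely generated module over the semigroup spanned by the generators of the cone, hence a
finite disjoint union of translates of simplicial semigroups, by Dickson's lemma
(`exists_hasGen_semigroup`, `exists_hasGen_cone`). So they have a generating function, and the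
identity theorem in `𝓜_ℓ(V*)` (`eq_of_eventually_eqOn_cone`) shows that it is `S(s + c)`
(`hasGen_genS`). In particular `S` is additive modulo cones with lines (`genS_eq_sum`).

For a unimodular cone `u` with generators `v_j`,
`M(s,u)(ξ) = e^⟨ξ,y⟩ ∏ 1 / (1 - e^⟨ξ,v_j⟩)` with `y = ∑ {-⟨η_j,s⟩} v_j` (`genM_unimodularCone`). As
the product has components in degrees at least `-d` only, expanding the exponential gives the
components of `M(s,u)` as step-polynomials in `s`, and those of `M(s,c)` follow by additivity
(`homComp_genM_mem`).

The component of lowest degree comes from Riemann sums: if `c` contains no line and `ξ` is in the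
domain of convergence, then `τ^d ∑ e^{τ⟨ξ,x⟩}`, summed over the lattice points of `s + c`, tends to
`∫_c e^⟨ξ,x⟩ dx` as `τ → 0⁺`, by dominated convergence
(`tendsto_pow_mul_integral_rescaledStep`). Comparison with the Laurent expansion in `τ` shows that
the components of degree less than `-d` vanish and that the component of degree `-d` is `I(c)`
(`exists_hasExpansion_genS`). The relation between the components of `S(s + c)` and `M(s,c)` is the
product of the Laurent expansions of `M(s,c)` and `e^⟨ξ,s⟩`.
-/

noncomputable section

namespace ConeSums

open Filter MeasureTheory

/-! ### Laurent expansions in one variable -/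

/-- A function with a convergent power series on a punctured neighbourhood of `0` tends to the
constant term. -/
theorem tendsto_of_hasSum_pow {c : ℕ → ℂ} {g : ℂ → ℂ}
    (h : ∀ᶠ τ in 𝓝[≠] (0 : ℂ), HasSum (fun k : ℕ => c k * τ ^ k) (g τ)) :
    Tendsto g (𝓝[≠] 0) (𝓝 (c 0)) := by
  obtain ⟨ε, hε, hb⟩ := Metric.mem_nhdsWithin_iff.mp h
  have hτ₀ : ((ε / 2 : ℝ) : ℂ) ∈ Metric.ball (0 : ℂ) ε ∩ {0}ᶜ := by
    refine ⟨?_, ?_⟩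
    · rw [mem_ball_zero_iff, Complex.norm_real, Real.norm_of_nonneg (by positivity)]
      linarith
    · simpa using hε.ne'
  have hs : Summable fun k : ℕ => ‖c k * ((ε / 2 : ℝ) : ℂ) ^ k‖ := (hb hτ₀).summable.norm
  have hc0 : c 0 = ∑' k : ℕ, (if k = 0 then c 0 else 0) := by
    rw [tsum_ite_eq]
  have key : Tendsto (fun τ : ℂ => ∑' k : ℕ, c k * τ ^ k) (𝓝[≠] 0)
      (𝓝 (∑' k : ℕ, (if k = 0 then c 0 else 0))) := by
    refine tendsto_tsum_of_dominated_convergence hs (fun k => ?_) ?_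
    · have : Continuous fun τ : ℂ => c k * τ ^ k := by fun_prop
      have h0 := (this.tendsto 0).mono_left (nhdsWithin_le_nhds (s := {0}ᶜ))
      rcases eq_or_ne k 0 with rfl | hk
      · simp
      · simpa [hk] using h0
    · have hmem : Metric.ball (0 : ℂ) (ε / 2) ∈ 𝓝[≠] (0 : ℂ) :=
        mem_nhdsWithin_of_mem_nhds (Metric.ball_mem_nhds _ (by positivity))
      filter_upwards [hmem] with τ hτ k
      rw [norm_mul, norm_mul, norm_pow, norm_pow, Complex.norm_real,
        Real.norm_of_nonneg (by positivity)]
      gcongr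
      exact (mem_ball_zero_iff.mp hτ).le
  rw [← hc0] at key
  refine key.congr' ?_
  filter_upwards [h] with τ hτ using hτ.tsum_eq

theorem eq_zero_of_hasSum_pow_zero {c : ℕ → ℂ}
    (h : ∀ᶠ τ in 𝓝[≠] (0 : ℂ), HasSum (fun k : ℕ => c k * τ ^ k) 0) (k : ℕ) : c k = 0 := by
  induction k generalizing c with
  | zero =>
    exact tendsto_nhds_unique (tendsto_of_hasSum_pow h) tendsto_const_nhds
  | succ k ih =>
    have h0 : c 0 = 0 := tendsto_nhds_unique (tendsto_of_hasSum_pow h) tendsto_const_nhds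
    refine ih (c := fun k => c (k + 1)) ?_
    filter_upwards [h, self_mem_nhdsWithin] with τ hτ hne
    have h1 := (hasSum_nat_add_iff' 1).mpr hτ
    have h2 := h1.mul_left τ⁻¹
    simp only [Finset.range_one, Finset.sum_singleton, h0, zero_mul, sub_zero, mul_zero] at h2
    refine h2.congr_fun fun k => ?_
    rw [pow_succ]
    field_simp [show τ ≠ 0 from hne]

theorem HasLaurent.hasSum_nat {g : ℂ → ℂ} {a : ℤ → ℂ} {N : ℕ} (h : HasLaurent g a)
    (hN : ∀ n < -(N : ℤ), a n = 0) :
    ∀ᶠ τ in 𝓝[≠] (0 : ℂ), HasSum (fun k : ℕ => a (k - N) * τ ^ k) (τ ^ N * g τ) := by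
  filter_upwards [h.2, self_mem_nhdsWithin] with τ hτ hne
  have hne : τ ≠ 0 := hne
  have hinj : Function.Injective fun k : ℕ => (k : ℤ) - N := fun x y hxy => by
    simpa using hxy
  have h1 := (hinj.hasSum_iff (f := fun n : ℤ => a n * τ ^ n) (a := g τ) (by
    intro n hn
    rw [hN n, zero_mul]
    by_contra hcon
    exact hn ⟨(n + N).toNat, by simp only; omega⟩)).mpr hτ
  have h2 := h1.mul_left (τ ^ N)
  refine h2.congr_fun fun k => ?_
  simp only [Function.comp_apply]
  rw [zpow_sub₀ hne, zpow_natCast, zpow_natCast]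
  field_simp

theorem hasLaurent_of_hasSum_nat {g : ℂ → ℂ} {c : ℕ → ℂ} (N : ℕ)
    (h : ∀ᶠ τ in 𝓝[≠] (0 : ℂ), HasSum (fun k : ℕ => c k * τ ^ k) (τ ^ N * g τ)) :
    HasLaurent g fun n => if 0 ≤ n + N then c (n + N).toNat else 0 := by
  refine ⟨⟨-N, fun n hn => if_neg (by omega)⟩, ?_⟩
  filter_upwards [h, self_mem_nhdsWithin] with τ hτ hne
  have hne : τ ≠ 0 := hne
  have hinj : Function.Injective fun k : ℕ => (k : ℤ) - N := fun x y hxy => by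
    simpa using hxy
  refine (hinj.hasSum_iff ?_).mp ?_
  · intro n hn
    rw [if_neg, zero_mul]
    intro hcon
    exact hn ⟨(n + N).toNat, by simp only; omega⟩
  · have h2 := hτ.mul_left ((τ ^ N)⁻¹)
    rw [inv_mul_cancel_left₀ (pow_ne_zero _ hne)] at h2
    refine h2.congr_fun fun k => ?_
    simp only [Function.comp_apply, sub_add_cancel, Nat.cast_nonneg, if_true, Int.toNat_natCast]
    rw [zpow_sub₀ hne, zpow_natCast, zpow_natCast]
    field_simp

theorem HasLaurent.exists_nat {g : ℂ → ℂ} {a : ℤ → ℂ} (h : HasLaurent g a) :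
    ∃ N : ℕ, ∀ n < -(N : ℤ), a n = 0 := by
  obtain ⟨n₀, hn₀⟩ := h.1
  exact ⟨n₀.natAbs, fun n hn => hn₀ n (by omega)⟩

theorem HasLaurent.add {g₁ g₂ : ℂ → ℂ} {a₁ a₂ : ℤ → ℂ} (h₁ : HasLaurent g₁ a₁)
    (h₂ : HasLaurent g₂ a₂) : HasLaurent (g₁ + g₂) (a₁ + a₂) := by
  obtain ⟨⟨n₁, hn₁⟩, h₁⟩ := h₁
  obtain ⟨⟨n₂, hn₂⟩, h₂⟩ := h₂
  refine ⟨⟨min n₁ n₂, fun n hn => ?_⟩, ?_⟩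
  · rw [lt_min_iff] at hn
    simp [hn₁ n hn.1, hn₂ n hn.2]
  · filter_upwards [h₁, h₂] with τ h₁ h₂
    simpa [add_mul] using h₁.add h₂

theorem HasLaurent.const_mul {g : ℂ → ℂ} {a : ℤ → ℂ} (h : HasLaurent g a) (z : ℂ) :
    HasLaurent (fun τ => z * g τ) fun n => z * a n := by
  obtain ⟨⟨n₁, hn₁⟩, h⟩ := h
  refine ⟨⟨n₁, fun n hn => by simp [hn₁ n hn]⟩, ?_⟩
  filter_upwards [h] with τ h
  simpa [mul_assoc] using h.mul_left z

theorem HasLaurent.unique {g : ℂ → ℂ} {a b : ℤ → ℂ} (ha : HasLaurent g a) (hb : HasLaurent g b) :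
    a = b := by
  have h := ha.add (hb.const_mul (-1))
  obtain ⟨N, hN⟩ := h.exists_nat
  have h0 := h.hasSum_nat hN
  have h1 : ∀ k : ℕ, (a + fun n => -1 * b n) (k - N) = 0 := by
    refine eq_zero_of_hasSum_pow_zero ?_
    filter_upwards [h0] with τ hτ
    simpa using hτ
  funext n
  have hn : (a + fun n => -1 * b n) n = 0 := by
    by_cases hc : n < -(N : ℤ)
    · exact hN n hc
    · have := h1 (n + N).toNat
      rwa [show (((n + N).toNat : ℕ) : ℤ) - N = n by omega] at this
  simpa [← sub_eq_add_neg, sub_eq_zero] using hn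

theorem HasLaurent.laurentCoeff_eq {g : ℂ → ℂ} {a : ℤ → ℂ} (h : HasLaurent g a) (m : ℤ) :
    laurentCoeff g m = a m := by
  have hex : ∃ a, HasLaurent g a := ⟨a, h⟩
  rw [laurentCoeff, dif_pos hex, hex.choose_spec.unique h]

theorem tendsto_ofReal_nhdsGT_zero : Tendsto (fun t : ℝ => (t : ℂ)) (𝓝[>] 0) (𝓝[≠] 0) := by
  refine tendsto_nhdsWithin_iff.mpr ⟨?_, ?_⟩
  · have := (Complex.continuous_ofReal.tendsto 0).mono_left (nhdsWithin_le_nhds (s := Set.Ioi 0))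
    simpa using this
  · filter_upwards [self_mem_nhdsWithin] with t ht
    simpa using (ne_of_gt ht : t ≠ 0)

/-- If `τ ^ d * g τ` has the limit `L` as `τ → 0⁺`, then the Laurent expansion of `g` starts in
degree at least `-d`, with the coefficient `L` in degree `-d`. -/
theorem HasLaurent.lowest_of_tendsto {g : ℂ → ℂ} {a : ℤ → ℂ} (h : HasLaurent g a) {d : ℕ} {L : ℂ}
    (hL : Tendsto (fun t : ℝ => (t : ℂ) ^ d * g t) (𝓝[>] 0) (𝓝 L)) :
    (∀ n < -(d : ℤ), a n = 0) ∧ a (-d) = L := by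
  have hof := tendsto_ofReal_nhdsGT_zero
  have hlow : ∀ e : ℕ, (∀ n < -((d + e : ℕ) : ℤ), a n = 0) → ∀ n < -(d : ℤ), a n = 0 := by
    intro e
    induction e with
    | zero => exact fun hn => by simpa using hn
    | succ e ih =>
      refine fun hn => ih fun n hlt => ?_
      by_cases hc : n < -((d + (e + 1) : ℕ) : ℤ)
      · exact hn n hc
      have h1 := (tendsto_of_hasSum_pow (h.hasSum_nat hn)).comp hof
      have h2 : Tendsto (fun t : ℝ => (t : ℂ) ^ (e + 1) * ((t : ℂ) ^ d * g t)) (𝓝[>] 0)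
          (𝓝 (0 ^ (e + 1) * L)) :=
        ((hof.mono_right nhdsWithin_le_nhds).pow _).mul hL
      have h3 : a (((0 : ℕ) : ℤ) - ((d + (e + 1) : ℕ) : ℤ)) = 0 ^ (e + 1) * L := by
        refine tendsto_nhds_unique h1 (h2.congr fun t => ?_)
        simp only [Function.comp_apply]
        ring
      rw [show n = ((0 : ℕ) : ℤ) - ((d + (e + 1) : ℕ) : ℤ) by push_cast at hlt hc ⊢; omega, h3]
      simp
  obtain ⟨N, hN⟩ := h.exists_nat
  have h0 := hlow N fun n hn => hN n (by push_cast at hn; omega)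
  refine ⟨h0, ?_⟩
  have h1 := (tendsto_of_hasSum_pow (h.hasSum_nat h0)).comp hof
  simpa using tendsto_nhds_unique h1 hL

/-- Multiplication of a Laurent expansion of order at least `-d` by `exp (τ z)`. -/
theorem HasLaurent.exp_mul {g : ℂ → ℂ} {a : ℤ → ℂ} (h : HasLaurent g a) {d : ℕ}
    (hd : ∀ n < -(d : ℤ), a n = 0) (z : ℂ) :
    HasLaurent (fun τ => Complex.exp (τ * z) * g τ) fun m =>
      ∑ r ∈ Finset.range (m + d + 1).toNat, z ^ r / (r.factorial : ℂ) * a (m - r) := by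
  have h1 : ∀ᶠ τ in 𝓝[≠] (0 : ℂ), HasSum
      (fun k : ℕ => (∑ r ∈ Finset.range (k + 1), z ^ r / (r.factorial : ℂ) * a (k - d - r)) * τ ^ k)
      (τ ^ d * (Complex.exp (τ * z) * g τ)) := by
    filter_upwards [h.hasSum_nat hd] with τ hτ
    have he : HasSum (fun r : ℕ => (τ * z) ^ r / (r.factorial : ℂ)) (Complex.exp (τ * z)) := by
      rw [Complex.exp_eq_exp_ℂ]
      exact NormedSpace.expSeries_div_hasSum_exp (τ * z)
    have hs := summable_norm_sum_mul_range_of_summable_norm he.summable.norm hτ.summable.norm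
    have hsum := hs.of_norm.hasSum
    rw [← tsum_mul_tsum_eq_tsum_sum_range_of_summable_norm he.summable.norm hτ.summable.norm,
      he.tsum_eq, hτ.tsum_eq] at hsum
    rw [show τ ^ d * (Complex.exp (τ * z) * g τ) = Complex.exp (τ * z) * (τ ^ d * g τ) by ring]
    refine hsum.congr_fun fun k => ?_
    rw [Finset.sum_mul]
    refine Finset.sum_congr rfl fun r hr => ?_
    have hrk : r ≤ k := Nat.lt_succ_iff.mp (Finset.mem_range.mp hr)
    rw [Nat.cast_sub hrk, show (k : ℤ) - d - r = (k : ℤ) - r - d by ring, mul_pow,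
      show τ ^ k = τ ^ r * τ ^ (k - r) by rw [← pow_add, Nat.add_sub_cancel' hrk]]
    ring
  convert hasLaurent_of_hasSum_nat d h1 using 1
  funext m
  split_ifs with hm
  · rw [show (m + d + 1).toNat = (m + d).toNat + 1 by omega]
    refine Finset.sum_congr rfl fun r _ => ?_
    rw [Int.toNat_of_nonneg hm, add_sub_cancel_right]
  · rw [show (m + d + 1).toNat = 0 by omega]
    simp

/-! ### Germs near zero, off hyperplanes -/

section Germs

variable {V : Type*} [NormedAddCommGroup V] [NormedSpace ℝ V]

theorem eventually_nearZero_iff {p : CDual V → Prop} :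
    (∀ᶠ ξ in nearZero V, p ξ) ↔ ∃ W : Finset V, (∀ w ∈ W, w ≠ 0) ∧
      ∀ᶠ ξ in 𝓝 (0 : CDual V), (∀ w ∈ W, ξ w ≠ 0) → p ξ := by
  classical
  constructor
  · intro h
    rw [nearZero, Filter.eventually_inf] at h
    obtain ⟨s, hs, t, ht, hp⟩ := h
    obtain ⟨I, hI, U, hU, rfl⟩ := Filter.mem_iInf.mp ht
    refine ⟨hI.toFinset.image Subtype.val, by simp +contextual, ?_⟩
    filter_upwards [hs] with ξ hξ hw
    refine hp ξ ⟨hξ, Set.mem_iInter.mpr fun i => ?_⟩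
    refine Filter.mem_principal.mp (hU i) ?_
    exact hw _ (Finset.mem_image.mpr ⟨i.1, by simp, rfl⟩)
  · rintro ⟨W, hW, h⟩
    have h1 : ∀ w ∈ W, ∀ᶠ ξ in nearZero V, ξ w ≠ 0 := fun w hw =>
      (Filter.eventually_of_mem (Filter.mem_iInf_of_mem (⟨w, hW w hw⟩ : {w : V // w ≠ 0})
        (Filter.mem_principal_self _)) fun ξ hξ => hξ).filter_mono inf_le_right
    have h2 : ∀ᶠ ξ in nearZero V, ∀ w ∈ W, ξ w ≠ 0 := (Filter.eventually_all_finset W).mpr h1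
    filter_upwards [h2, h.filter_mono inf_le_left] with ξ h2 h3 using h3 h2

theorem eventually_apply_ne_zero {w : V} (hw : w ≠ 0) : ∀ᶠ ξ in nearZero V, ξ w ≠ 0 :=
  eventually_nearZero_iff.mpr ⟨{w}, by simpa using hw, by simp⟩

/-- Evaluation at `x ∈ V`, a complex linear form on `V*_ℂ`. -/
def evalC (x : V) : CDual V →L[ℂ] ℂ :=
  LinearMap.mkContinuous
    { toFun := fun ξ => ξ x
      map_add' := fun _ _ => rfl
      map_smul' := fun _ _ => rfl } ‖x‖ fun ξ => by
        rw [mul_comm]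
        exact ξ.le_opNorm x

theorem analyticAt_dual_apply (x : V) (ξ : CDual V) : AnalyticAt ℂ (fun ξ : CDual V => ξ x) ξ :=
  (evalC x).analyticAt ξ

theorem continuous_dual_apply (x : V) : Continuous fun ξ : CDual V => ξ x :=
  (evalC x).continuous

theorem analyticAt_prod_apply {ι : Type*} (s : Finset ι) (w : ι → V) (ξ : CDual V) :
    AnalyticAt ℂ (fun ξ : CDual V => ∏ j ∈ s, ξ (w j)) ξ :=
  Finset.analyticAt_fun_prod s fun j _ => analyticAt_dual_apply (w j) ξ

theorem analyticAt_of_mem_homPolyDual {k : ℕ} {P : CDual V → ℂ} (hP : P ∈ homPolyDual V k)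
    (ξ : CDual V) : AnalyticAt ℂ P ξ := by
  induction hP using Submodule.span_induction with
  | mem P hP =>
    obtain ⟨x, rfl⟩ := hP
    exact analyticAt_prod_apply _ _ ξ
  | zero => exact analyticAt_const
  | add f g _ _ hf hg => exact hf.add hg
  | smul z f _ hf => exact analyticAt_const.mul hf

theorem homRat_subset_meroLin (m : ℤ) : HomRat V m ⊆ MeroLin V := by
  rintro F ⟨N, k, w, P, -, hw, hP, rfl⟩
  exact ⟨N, w, P, hw, analyticAt_of_mem_homPolyDual hP 0, rfl⟩

theorem zero_mem_meroLin : (0 : FGerm V) ∈ MeroLin V :=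
  ⟨0, Fin.elim0, fun _ => 0, fun j => j.elim0, analyticAt_const, by
    simp only [zero_div]
    rfl⟩

/-- Identity theorem for `𝓜_ℓ(V*)`: an element is determined by its values on the points near `0`
of a nonempty open cone. -/
theorem eq_of_eventually_eqOn_cone {F F' : FGerm V} (hF : F ∈ MeroLin V) (hF' : F' ∈ MeroLin V)
    {f f' : CDual V → ℂ} (hf : F = f) (hf' : F' = f') {D : Set (CDual V)} (hDo : IsOpen D)
    (hDne : D.Nonempty) (hD : ∀ ξ ∈ D, ∀ t : ℝ, 0 < t → (t : ℂ) • ξ ∈ D)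
    (h : ∀ᶠ ξ in nearZero V, ξ ∈ D → f ξ = f' ξ) : F = F' := by
  obtain ⟨N, w, φ, hw, hφ, hFφ⟩ := hF
  obtain ⟨N', w', φ', hw', hφ', hFφ'⟩ := hF'
  have e1 : ∀ᶠ ξ in nearZero V, f ξ = φ ξ / ∏ j, ξ (w j) :=
    Filter.Germ.coe_eq.mp (hf.symm.trans hFφ)
  have e2 : ∀ᶠ ξ in nearZero V, f' ξ = φ' ξ / ∏ j, ξ (w' j) :=
    Filter.Germ.coe_eq.mp (hf'.symm.trans hFφ')
  have hw0 : ∀ᶠ ξ in nearZero V, ∀ j, ξ (w j) ≠ 0 :=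
    Filter.eventually_all.mpr fun j => eventually_apply_ne_zero (hw j)
  have hw0' : ∀ᶠ ξ in nearZero V, ∀ j, ξ (w' j) ≠ 0 :=
    Filter.eventually_all.mpr fun j => eventually_apply_ne_zero (hw' j)
  set H : CDual V → ℂ := fun ξ => φ ξ * ∏ j, ξ (w' j) - φ' ξ * ∏ j, ξ (w j) with hH
  have hH0 : ∀ᶠ ξ in nearZero V, ξ ∈ D → H ξ = 0 := by
    filter_upwards [h, e1, e2, hw0, hw0'] with ξ h e1 e2 h0 h0' hξ
    have h1 : ∏ j, ξ (w j) ≠ 0 := Finset.prod_ne_zero_iff.mpr fun j _ => h0 j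
    have h2 : ∏ j, ξ (w' j) ≠ 0 := Finset.prod_ne_zero_iff.mpr fun j _ => h0' j
    have := h hξ
    rw [e1, e2, div_eq_div_iff h1 h2] at this
    rw [hH]
    exact sub_eq_zero.mpr this
  obtain ⟨W, hW, hW0⟩ := eventually_nearZero_iff.mp hH0
  -- Multiplying by the equations of the excluded hyperplanes gives a function which is analytic
  -- near `0` and vanishes at all points of the cone near `0`.
  set K : CDual V → ℂ := fun ξ => H ξ * ∏ x ∈ W, ξ x with hK
  have hKa : AnalyticAt ℂ K 0 :=
    ((hφ.mul (analyticAt_prod_apply _ _ 0)).sub (hφ'.mul (analyticAt_prod_apply _ _ 0))).mul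
      (analyticAt_prod_apply _ _ 0)
  have hK0 : ∀ᶠ ξ in 𝓝 (0 : CDual V), ξ ∈ D → K ξ = 0 := by
    filter_upwards [hW0] with ξ hξ hD
    by_cases hc : ∀ x ∈ W, ξ x ≠ 0
    · rw [hK]
      simp only
      rw [hξ hc hD, zero_mul]
    · push Not at hc
      obtain ⟨x, hx, hx0⟩ := hc
      rw [hK]
      simp only
      rw [Finset.prod_eq_zero hx hx0, mul_zero]
  obtain ⟨ε, hε, hball⟩ := Metric.eventually_nhds_iff_ball.mp (hKa.eventually_analyticAt.and hK0)
  obtain ⟨ξ₀, hξ₀⟩ := hDne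
  obtain ⟨ξ₁, hξ₁D, hξ₁⟩ : ∃ ξ₁ ∈ D, ξ₁ ∈ Metric.ball (0 : CDual V) ε := by
    refine ⟨((ε / 2 / (‖ξ₀‖ + 1) : ℝ) : ℂ) • ξ₀, hD _ hξ₀ _ (by positivity), ?_⟩
    rw [mem_ball_zero_iff, norm_smul, Complex.norm_real, Real.norm_of_nonneg (by positivity),
      div_mul_eq_mul_div, div_lt_iff₀ (by positivity)]
    nlinarith [norm_nonneg ξ₀]
  have hloc : K =ᶠ[𝓝 ξ₁] 0 := by
    filter_upwards [hDo.mem_nhds hξ₁D, Metric.isOpen_ball.mem_nhds hξ₁] with ξ h1 h2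
    exact (hball ξ h2).2 h1
  have hzero := AnalyticOnNhd.eqOn_zero_of_preconnected_of_eventuallyEq_zero
    (fun ξ hξ => (hball ξ hξ).1) (convex_ball (0 : CDual V) ε).isPreconnected hξ₁ hloc
  rw [hFφ, hFφ']
  refine Filter.Germ.coe_eq.mpr ?_
  have hgen : ∀ᶠ ξ in nearZero V, ∀ x ∈ W, ξ x ≠ 0 :=
    (Filter.eventually_all_finset W).mpr fun x hx => eventually_apply_ne_zero (hW x hx)
  have hnear : ∀ᶠ ξ in nearZero V, ξ ∈ Metric.ball (0 : CDual V) ε :=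
    Filter.Eventually.filter_mono inf_le_left (Metric.ball_mem_nhds _ hε)
  filter_upwards [hw0, hw0', hgen, hnear] with ξ h0 h0' hg hn
  have h1 : ∏ j, ξ (w j) ≠ 0 := Finset.prod_ne_zero_iff.mpr fun j _ => h0 j
  have h2 : ∏ j, ξ (w' j) ≠ 0 := Finset.prod_ne_zero_iff.mpr fun j _ => h0' j
  have h3 : ∏ x ∈ W, ξ x ≠ 0 := Finset.prod_ne_zero_iff.mpr hg
  rw [div_eq_div_iff h1 h2]
  have h4 : H ξ = 0 := by
    have := hzero hn
    simpa [hK, h3] using this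
  exact sub_eq_zero.mp h4

/-- A continuation from a partial function which is defined on a nonempty open cone is unique. -/
theorem continuation_eq {val : CDual V → ℂ → Prop} {F : FGerm V} (hF : IsContinuation val F)
    {D : Set (CDual V)} (hDo : IsOpen D) (hDne : D.Nonempty)
    (hD : ∀ ξ ∈ D, ∀ t : ℝ, 0 < t → (t : ℂ) • ξ ∈ D) (hval : ∀ ξ ∈ D, ∃ z, val ξ z) :
    continuation val = F := by
  have hex : ∃ F, IsContinuation val F := ⟨F, hF⟩
  rw [continuation, dif_pos hex]
  obtain ⟨h1, f, hf, hfv⟩ := hex.choose_spec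
  obtain ⟨h1', f', hf', hfv'⟩ := hF
  refine eq_of_eventually_eqOn_cone h1 h1' hf hf' hDo hDne hD ?_
  filter_upwards [hfv, hfv'] with ξ h h' hξ
  obtain ⟨z, hz⟩ := hval ξ hξ
  rw [h z hz, h' z hz]

/-! ### Homogeneous components -/

/-- The germ `F` has along almost every line through `0` the Laurent expansion
`F(τξ) = ∑ τ^n a n ξ`. -/
def HasExpansion (F : FGerm V) (a : ℤ → CDual V → ℂ) : Prop :=
  ∃ f : CDual V → ℂ, F = f ∧ ∀ᶠ ξ in nearZero V, HasLaurent (fun τ => f (τ • ξ)) fun n => a n ξ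

theorem HasExpansion.homComp_eq {F : FGerm V} {a : ℤ → CDual V → ℂ} (h : HasExpansion F a)
    (m : ℤ) : homComp F m = (a m : FGerm V) := by
  obtain ⟨f, rfl, hf⟩ := h
  refine Filter.Germ.coe_eq.mpr ?_
  filter_upwards [hf] with ξ hξ
  exact hξ.laurentCoeff_eq m

theorem HasLaurent.congr {g₁ g₂ : ℂ → ℂ} {a : ℤ → ℂ} (h : HasLaurent g₁ a)
    (hg : g₁ =ᶠ[𝓝[≠] (0 : ℂ)] g₂) : HasLaurent g₂ a := by
  refine ⟨h.1, ?_⟩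
  filter_upwards [h.2, hg] with τ h1 h2
  rwa [← h2]

theorem HasExpansion.hasLaurent {F : FGerm V} {a : ℤ → CDual V → ℂ} (h : HasExpansion F a)
    {f : CDual V → ℂ} (hf : F = f) :
    ∀ᶠ ξ in nearZero V, HasLaurent (fun τ => f (τ • ξ)) fun n => a n ξ := by
  obtain ⟨f', hf', h⟩ := h
  have h1 : ∀ᶠ ξ in nearZero V, f' ξ = f ξ := Filter.Germ.coe_eq.mp (hf'.symm.trans hf)
  filter_upwards [h, eventually_ray h1] with ξ h2 h3 using h2.congr h3

theorem HasExpansion.add {F G : FGerm V} {a b : ℤ → CDual V → ℂ} (h : HasExpansion F a)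
    (h' : HasExpansion G b) : HasExpansion (F + G) (a + b) := by
  obtain ⟨f, rfl, h⟩ := h
  obtain ⟨g, rfl, h'⟩ := h'
  refine ⟨f + g, rfl, ?_⟩
  filter_upwards [h, h'] with ξ h1 h2 using h1.add h2

theorem HasExpansion.smul {F : FGerm V} {a : ℤ → CDual V → ℂ} (h : HasExpansion F a) (r : ℝ) :
    HasExpansion (r • F) (r • a) := by
  obtain ⟨f, rfl, h⟩ := h
  refine ⟨r • f, rfl, ?_⟩
  filter_upwards [h] with ξ h1
  simpa using h1.const_mul (r : ℂ)

theorem HasExpansion.zero : HasExpansion (0 : FGerm V) 0 := by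
  refine ⟨0, rfl, Filter.Eventually.of_forall fun ξ => ⟨⟨0, fun _ _ => rfl⟩, ?_⟩⟩
  refine Filter.Eventually.of_forall fun τ => ?_
  simp [hasSum_zero]

theorem HasExpansion.sum {ι : Type*} (s : Finset ι) {F : ι → FGerm V}
    {a : ι → ℤ → CDual V → ℂ} (h : ∀ i ∈ s, HasExpansion (F i) (a i)) :
    HasExpansion (∑ i ∈ s, F i) (∑ i ∈ s, a i) := by
  classical
  induction s using Finset.induction_on with
  | empty => exact HasExpansion.zero
  | insert i s hi ih =>
    rw [Finset.sum_insert hi, Finset.sum_insert hi]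
    exact (h i (Finset.mem_insert_self i s)).add
      (ih fun j hj => h j (Finset.mem_insert_of_mem hj))

/-- Multiplication by `e^⟨ξ,x⟩` of a germ whose expansion starts in degree at least `-d`. -/
theorem HasExpansion.exp_mul {F : FGerm V} {a : ℤ → CDual V → ℂ} (h : HasExpansion F a) {d : ℕ}
    (hd : ∀ᶠ ξ in nearZero V, ∀ n < -(d : ℤ), a n ξ = 0) (x : V) :
    HasExpansion (((fun ξ => Complex.exp (ξ x) : CDual V → ℂ) : FGerm V) * F) fun m ξ =>
      ∑ r ∈ Finset.range (m + d + 1).toNat, ξ x ^ r / (r.factorial : ℂ) * a (m - r) ξ := by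
  obtain ⟨f, rfl, h⟩ := h
  refine ⟨fun ξ => Complex.exp (ξ x) * f ξ, rfl, ?_⟩
  filter_upwards [h, hd] with ξ h1 h2
  exact h1.exp_mul h2 (ξ x)

/-- The terms of a power series at `0` are homogeneous polynomials: expand in the coordinates
`ξ ↦ ⟨ξ,b_i⟩` given by a basis of `V`. -/
theorem diag_mem_homPolyDual [FiniteDimensional ℝ V] {k : ℕ}
    (p : ContinuousMultilinearMap ℂ (fun _ : Fin k => CDual V) ℂ) :
    (fun ξ : CDual V => p fun _ => ξ) ∈ homPolyDual V k := by
  classical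
  set b := Module.finBasis ℝ V
  set e : Fin (Module.finrank ℝ V) → CDual V := fun i =>
    Complex.ofRealCLM.comp (LinearMap.toContinuousLinearMap (b.coord i)) with he
  have hexp : ∀ ξ : CDual V, ξ = ∑ i, ξ (b i) • e i := by
    intro ξ
    ext x
    conv_lhs => rw [← b.sum_repr x, map_sum]
    rw [_root_.sum_apply]
    refine Finset.sum_congr rfl fun i _ => ?_
    rw [map_smul, Complex.real_smul, _root_.smul_apply, smul_eq_mul, mul_comm]
    rfl
  have : (fun ξ : CDual V => p fun _ => ξ) =
      ∑ J : Fin k → Fin (Module.finrank ℝ V),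
        (p fun i => e (J i)) • fun ξ : CDual V => ∏ i, ξ (b (J i)) := by
    funext ξ
    rw [Finset.sum_apply]
    conv_lhs => rw [hexp ξ]
    rw [p.map_sum]
    refine Finset.sum_congr rfl fun J _ => ?_
    rw [p.map_smul_univ, Pi.smul_apply, smul_eq_mul, smul_eq_mul, mul_comm]
  rw [this]
  exact Submodule.sum_mem _ fun J _ => Submodule.smul_mem _ _ (Submodule.subset_span ⟨_, rfl⟩)

/-- The expansion of `φ / ∏ ⟨ξ,w_j⟩` comes from the power series of `φ`: its homogeneous components
are elements of `𝓡_[n]`, and vanish for `n < -N`. -/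
theorem hasExpansion_div [FiniteDimensional ℝ V] {N : ℕ} (w : Fin N → V) (hw : ∀ j, w j ≠ 0)
    {φ : CDual V → ℂ} (hφ : AnalyticAt ℂ φ 0) :
    ∃ a : ℤ → CDual V → ℂ,
      HasExpansion ((fun ξ => φ ξ / ∏ j, ξ (w j) : CDual V → ℂ) : FGerm V) a ∧
      (∀ n < -(N : ℤ), a n = 0) ∧
      (∀ n, -(N : ℤ) ≤ n → (a n : FGerm V) ∈ HomRat V n) := by
  obtain ⟨p, r, hp⟩ := hφ
  refine ⟨fun n => if 0 ≤ n + N then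
      fun ξ => (p (n + N).toNat fun _ => ξ) / ∏ j, ξ (w j) else 0, ⟨_, rfl, ?_⟩, ?_, ?_⟩
  · refine Filter.Eventually.of_forall fun ξ => ?_
    have h1 : ∀ᶠ τ in 𝓝[≠] (0 : ℂ), HasSum
        (fun k : ℕ => ((p k fun _ => ξ) / ∏ j, ξ (w j)) * τ ^ k)
        (τ ^ N * (φ (τ • ξ) / ∏ j, (τ • ξ) (w j))) := by
      have hc : Tendsto (fun τ : ℂ => τ • ξ) (𝓝[≠] 0) (𝓝 0) := by
        have : Continuous fun τ : ℂ => τ • ξ := by fun_prop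
        have h0 := this.tendsto 0
        rw [show (0 : ℂ) • ξ = 0 from zero_smul ℂ ξ] at h0
        exact h0.mono_left nhdsWithin_le_nhds
      filter_upwards [hc (Metric.eball_mem_nhds 0 hp.r_pos), self_mem_nhdsWithin] with τ h1 h2
      have h2 : τ ≠ 0 := h2
      have h3 := (hp.hasSum h1).div_const (∏ j, ξ (w j))
      rw [zero_add] at h3
      have h4 : τ ^ N * (φ (τ • ξ) / ∏ j, (τ • ξ) (w j)) = φ (τ • ξ) / ∏ j, ξ (w j) := by
        simp only [_root_.smul_apply, smul_eq_mul, Finset.prod_mul_distrib,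
          Finset.prod_const, Finset.card_univ, Fintype.card_fin]
        rw [mul_div_assoc', mul_div_mul_left _ _ (pow_ne_zero _ h2)]
      rw [h4]
      refine h3.congr_fun fun k => ?_
      have := (p k).map_smul_univ (fun _ => τ) fun _ => ξ
      simp only [Finset.prod_const, Finset.card_univ, Fintype.card_fin, smul_eq_mul] at this
      rw [this]
      ring
    convert hasLaurent_of_hasSum_nat N h1 using 1
    funext n
    by_cases hn : 0 ≤ n + N <;> simp [hn]
  · intro n hn
    simp only
    rw [if_neg (by omega)]
  · intro n hn
    simp only
    rw [if_pos (by omega)]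
    exact ⟨N, (n + N).toNat, w, fun ξ => p (n + N).toNat fun _ => ξ, by omega, hw,
      diag_mem_homPolyDual _, rfl⟩

theorem exists_hasExpansion [FiniteDimensional ℝ V] {F : FGerm V} (hF : F ∈ MeroLin V) :
    ∃ (a : ℤ → CDual V → ℂ) (N : ℕ), HasExpansion F a ∧ (∀ n < -(N : ℤ), a n = 0) ∧
      ∀ n, (a n : FGerm V) ∈ MeroLin V := by
  obtain ⟨N, w, φ, hw, hφ, rfl⟩ := hF
  obtain ⟨a, h1, h2, h3⟩ := hasExpansion_div w hw hφ
  refine ⟨a, N, h1, h2, fun n => ?_⟩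
  by_cases hn : n < -(N : ℤ)
  · rw [h2 n hn]
    exact zero_mem_meroLin
  · exact homRat_subset_meroLin n (h3 n (not_lt.mp hn))

end Germs

/-! ### Generating functions of functions annihilated by difference operators -/

section DiffOp

variable {V : Type*} [AddCommGroup V]

/-- The difference operator `f ↦ f - f(· - w)`. -/
def diffOp (w : V) : Module.End ℂ (V → ℂ) where
  toFun f x := f x - f (x - w)
  map_add' f g := by
    funext x
    simp only [Pi.add_apply]
    ring
  map_smul' z f := by
    funext x
    simp only [Pi.smul_apply, smul_eq_mul, RingHom.id_apply]
    ring

theorem diffOp_apply (w : V) (f : V → ℂ) (x : V) : diffOp w f x = f x - f (x - w) := rfl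

theorem commute_diffOp (v w : V) : Commute (diffOp v) (diffOp w) := by
  refine LinearMap.ext fun f => funext fun x => ?_
  simp only [Module.End.mul_apply, diffOp_apply, sub_right_comm x v w]
  ring

/-- The product of the difference operators of a list of vectors. -/
def diffOps (w : List V) : Module.End ℂ (V → ℂ) := (w.map diffOp).prod

theorem diffOps_append (v w : List V) : diffOps (v ++ w) = diffOps v * diffOps w := by
  simp [diffOps]

theorem commute_diffOps (v w : List V) : Commute (diffOps v) (diffOps w) := by
  refine Commute.list_prod_right _ _ fun x hx => Commute.list_prod_left _ _ fun y hy => ?_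
  obtain ⟨a, -, rfl⟩ := List.mem_map.mp hx
  obtain ⟨b, -, rfl⟩ := List.mem_map.mp hy
  exact commute_diffOp b a

theorem finite_support_diffOp {f : V → ℂ} (hf : f.support.Finite) (w : V) :
    (diffOp w f).support.Finite := by
  refine (hf.union (hf.image (· + w))).subset fun x hx => ?_
  by_contra hcon
  simp only [Set.mem_union, Function.mem_support, Set.mem_image, not_or, not_not, not_exists,
    not_and] at hcon
  refine hx ?_
  rw [diffOp_apply, hcon.1, zero_sub, neg_eq_zero]
  by_contra h
  exact hcon.2 (x - w) h (sub_add_cancel x w)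

theorem finite_support_diffOps {f : V → ℂ} (hf : f.support.Finite) (w : List V) :
    (diffOps w f).support.Finite := by
  induction w with
  | nil => simpa [diffOps] using hf
  | cons v w ih => simpa [diffOps] using finite_support_diffOp ih v

end DiffOp

section Gen

variable {V : Type*} [NormedAddCommGroup V] [NormedSpace ℝ V]

/-- The germ of `1 - e^⟨ξ,w⟩`, by which `diffOp w` multiplies generating functions. -/
def oneSubExp (w : V) : FGerm V := ((fun ξ => 1 - Complex.exp (ξ w) : CDual V → ℂ) : FGerm V)

theorem eventually_one_sub_exp_ne_zero {w : V} (hw : w ≠ 0) :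
    ∀ᶠ ξ in nearZero V, 1 - Complex.exp (ξ w) ≠ 0 := by
  have h1 : ∀ᶠ ξ in 𝓝 (0 : CDual V), ‖ξ w‖ < 1 := by
    have : Continuous fun ξ : CDual V => ‖ξ w‖ := (continuous_dual_apply w).norm
    exact this.continuousAt.eventually_lt continuousAt_const (by simp)
  filter_upwards [eventually_apply_ne_zero hw, h1.filter_mono inf_le_left] with ξ h2 h3 h4
  rw [sub_eq_zero, eq_comm, Complex.exp_eq_one_iff] at h4
  obtain ⟨n, hn⟩ := h4
  rcases eq_or_ne n 0 with rfl | hn0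
  · exact h2 (by simpa using hn)
  · rw [hn] at h3
    have h5 : (1 : ℝ) ≤ |(n : ℝ)| := by
      exact_mod_cast Int.one_le_abs hn0
    simp only [norm_mul, Complex.norm_intCast, Complex.norm_ofNat, Complex.norm_real,
      Complex.norm_I, mul_one, Real.norm_of_nonneg Real.pi_pos.le] at h3
    nlinarith [Real.pi_gt_three]

theorem exists_oneSubExp_mul_eq_one {w : V} (hw : w ≠ 0) : ∃ E : FGerm V, oneSubExp w * E = 1 := by
  refine ⟨((fun ξ => (1 - Complex.exp (ξ w))⁻¹ : CDual V → ℂ) : FGerm V), ?_⟩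
  refine Filter.Germ.coe_eq.mpr ?_
  filter_upwards [eventually_one_sub_exp_ne_zero hw] with ξ hξ
  exact mul_inv_cancel₀ hξ

theorem isUnit_oneSubExp {w : V} (hw : w ≠ 0) : IsUnit (oneSubExp w) := by
  obtain ⟨E, hE⟩ := exists_oneSubExp_mul_eq_one hw
  exact IsUnit.of_mul_eq_one E hE

theorem isUnit_prod_oneSubExp {w : List V} (hw : ∀ v ∈ w, v ≠ 0) :
    IsUnit (w.map oneSubExp).prod := by
  induction w with
  | nil => simp
  | cons v w ih =>
    rw [List.map_cons, List.prod_cons]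
    exact (isUnit_oneSubExp (hw v (by simp))).mul (ih fun u hu => hw u (by simp [hu]))

/-- The exponential sum `∑ f(x) e^⟨ξ,x⟩`; used for functions `f` with finite support. -/
def expSum (f : V → ℂ) (ξ : CDual V) : ℂ := ∑' x, f x * Complex.exp (ξ x)

theorem hasSum_expSum {f : V → ℂ} (hf : f.support.Finite) (ξ : CDual V) :
    HasSum (fun x => f x * Complex.exp (ξ x)) (expSum f ξ) := by
  refine (summable_of_hasFiniteSupport (hf.subset fun x hx => ?_)).hasSum
  exact left_ne_zero_of_mul hx

theorem hasSum_diffOp {f : V → ℂ} {ξ : CDual V} {z : ℂ}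
    (h : HasSum (fun x => f x * Complex.exp (ξ x)) z) (w : V) :
    HasSum (fun x => diffOp w f x * Complex.exp (ξ x)) ((1 - Complex.exp (ξ w)) * z) := by
  have h1 := ((Equiv.subRight w).hasSum_iff.mpr h).mul_left (Complex.exp (ξ w))
  have h2 := h.sub h1
  rw [show (1 - Complex.exp (ξ w)) * z = z - Complex.exp (ξ w) * z by ring]
  refine h2.congr_fun fun x => ?_
  simp only [Function.comp_apply, Equiv.subRight_apply, diffOp_apply, map_sub, Complex.exp_sub]
  field_simp [Complex.exp_ne_zero]

theorem hasSum_diffOps {f : V → ℂ} {ξ : CDual V} {z : ℂ}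
    (h : HasSum (fun x => f x * Complex.exp (ξ x)) z) (w : List V) :
    HasSum (fun x => diffOps w f x * Complex.exp (ξ x))
      ((w.map fun v => 1 - Complex.exp (ξ v)).prod * z) := by
  induction w with
  | nil => simpa [diffOps] using h
  | cons v w ih =>
    have := hasSum_diffOp ih v
    rw [List.map_cons, List.prod_cons, mul_assoc]
    simpa [diffOps] using this

theorem coe_prod_map (w : List V) :
    (((fun ξ => (w.map fun v => 1 - Complex.exp (ξ v)).prod : CDual V → ℂ)) : FGerm V) =
      (w.map oneSubExp).prod := by
  induction w with
  | nil => rfl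
  | cons v w ih =>
    rw [List.map_cons, List.prod_cons, ← ih]
    rfl

theorem coe_expSum_diffOps {f : V → ℂ} (hf : f.support.Finite) (w : List V) :
    (expSum (diffOps w f) : FGerm V) = (w.map oneSubExp).prod * (expSum f : FGerm V) := by
  rw [← coe_prod_map, ← Filter.Germ.coe_mul]
  congr 1
  funext ξ
  exact (hasSum_expSum (finite_support_diffOps hf w) ξ).unique
    (hasSum_diffOps (hasSum_expSum hf ξ) w)

/-- The germ `F` is the generating function of `f : V → ℂ`: a product of difference operators
`f ↦ f - f(· - w)`, `w ≠ 0`, makes the support of `f` finite, and multiplying `F` by the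
corresponding factors `1 - e^⟨ξ,w⟩` gives the exponential sum of the resulting function. -/
def HasGen (f : V → ℂ) (F : FGerm V) : Prop :=
  ∃ w : List V, (∀ v ∈ w, v ≠ 0) ∧ (diffOps w f).support.Finite ∧
    (w.map oneSubExp).prod * F = (expSum (diffOps w f) : FGerm V)

theorem HasGen.of_finite {f : V → ℂ} (hf : f.support.Finite) : HasGen f (expSum f : FGerm V) :=
  ⟨[], by simp, by simpa [diffOps] using hf, by simp [diffOps]⟩

theorem HasGen.zero : HasGen (0 : V → ℂ) 0 :=
  ⟨[], by simp, by simp, by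
    rw [map_zero, List.map_nil, List.prod_nil, mul_zero]
    refine Filter.Germ.coe_eq.mpr (Filter.Eventually.of_forall fun ξ => ?_)
    simp [expSum]⟩

theorem extend_diffOps {f : V → ℂ} {F : FGerm V} {w : List V}
    (hf : (diffOps w f).support.Finite)
    (hF : (w.map oneSubExp).prod * F = (expSum (diffOps w f) : FGerm V)) (u : List V) :
    (diffOps (u ++ w) f).support.Finite ∧
      ((u ++ w).map oneSubExp).prod * F = (expSum (diffOps (u ++ w) f) : FGerm V) := by
  rw [diffOps_append, Module.End.mul_apply]
  refine ⟨finite_support_diffOps hf u, ?_⟩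
  rw [coe_expSum_diffOps hf, ← hF, List.map_append, List.prod_append, mul_assoc]

/-- Two generating functions can be computed with the same difference operators. -/
theorem HasGen.common {f g : V → ℂ} {F G : FGerm V} (hf : HasGen f F) (hg : HasGen g G) :
    ∃ w : List V, (∀ v ∈ w, v ≠ 0) ∧
      ((diffOps w f).support.Finite ∧
        (w.map oneSubExp).prod * F = (expSum (diffOps w f) : FGerm V)) ∧
      ((diffOps w g).support.Finite ∧
        (w.map oneSubExp).prod * G = (expSum (diffOps w g) : FGerm V)) := by
  obtain ⟨u, hu, hu1, hu2⟩ := hf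
  obtain ⟨w, hw, hw1, hw2⟩ := hg
  refine ⟨w ++ u, ?_, extend_diffOps hu1 hu2 w, ?_⟩
  · intro v hv
    exact (List.mem_append.mp hv).elim (hw v) (hu v)
  · have h := extend_diffOps hw1 hw2 u
    rw [diffOps_append, (commute_diffOps u w).eq, ← diffOps_append, List.map_append,
      List.prod_append, mul_comm (u.map oneSubExp).prod, ← List.prod_append,
      ← List.map_append] at h
    exact h

theorem HasGen.unique {f : V → ℂ} {F G : FGerm V} (hF : HasGen f F) (hG : HasGen f G) :
    F = G := by
  obtain ⟨w, hw, h1, h2⟩ := hF.common hG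
  exact (isUnit_prod_oneSubExp hw).mul_left_cancel (h1.2.trans h2.2.symm)

theorem HasGen.add {f g : V → ℂ} {F G : FGerm V} (hF : HasGen f F) (hG : HasGen g G) :
    HasGen (f + g) (F + G) := by
  obtain ⟨w, hw, h1, h2⟩ := hF.common hG
  refine ⟨w, hw, ?_, ?_⟩
  · rw [map_add]
    exact (h1.1.union h2.1).subset (Function.support_add _ _)
  · rw [mul_add, h1.2, h2.2, ← Filter.Germ.coe_add]
    congr 1
    funext ξ
    rw [map_add]
    refine HasSum.unique ?_ (hasSum_expSum ?_ ξ)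
    · refine ((hasSum_expSum h1.1 ξ).add (hasSum_expSum h2.1 ξ)).congr_fun fun x => ?_
      simp [add_mul]
    · exact (h1.1.union h2.1).subset (Function.support_add _ _)

theorem HasGen.smul {f : V → ℂ} {F : FGerm V} (hF : HasGen f F) (r : ℝ) :
    HasGen ((r : ℂ) • f) (r • F) := by
  obtain ⟨w, hw, h1, h2⟩ := hF
  have h3 : (diffOps w ((r : ℂ) • f)).support.Finite := by
    rw [map_smul]
    exact h1.subset (Function.support_const_smul_subset _ _)
  refine ⟨w, hw, h3, ?_⟩
  have hcomm : (w.map oneSubExp).prod * (r • F) = r • ((w.map oneSubExp).prod * F) := by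
    induction F using Filter.Germ.inductionOn with | _ g
    rw [← coe_prod_map, ← Filter.Germ.coe_smul, ← Filter.Germ.coe_mul, mul_smul_comm]
    rfl
  rw [hcomm, h2, ← Filter.Germ.coe_smul]
  congr 1
  funext ξ
  refine HasSum.unique ?_ (hasSum_expSum h3 ξ)
  refine ((hasSum_expSum h1 ξ).mul_left (r : ℂ)).congr_fun fun x => ?_
  simp [mul_assoc]

theorem HasGen.sum {ι : Type*} (s : Finset ι) {f : ι → V → ℂ} {F : ι → FGerm V}
    (h : ∀ i ∈ s, HasGen (f i) (F i)) : HasGen (∑ i ∈ s, f i) (∑ i ∈ s, F i) := by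
  classical
  induction s using Finset.induction_on with
  | empty => exact HasGen.zero
  | insert i s hi ih =>
    rw [Finset.sum_insert hi, Finset.sum_insert hi]
    exact (h i (Finset.mem_insert_self i s)).add
      (ih fun j hj => h j (Finset.mem_insert_of_mem hj))

theorem HasGen.of_diffOp {f : V → ℂ} {F G : FGerm V} {v : V} (hv : v ≠ 0)
    (h : HasGen (diffOp v f) G) (hF : oneSubExp v * F = G) : HasGen f F := by
  obtain ⟨w, hw, h1, h2⟩ := h
  have h3 : diffOps (w ++ [v]) f = diffOps w (diffOp v f) := by
    rw [diffOps_append]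
    simp [diffOps]
  refine ⟨w ++ [v], ?_, by rwa [h3], ?_⟩
  · intro u hu
    rcases List.mem_append.mp hu with hu | hu
    · exact hw u hu
    · rwa [List.mem_singleton.mp hu]
  · rw [h3, ← h2, ← hF, List.map_append, List.prod_append, mul_assoc]
    simp

theorem HasGen.exists_of_diffOp {f : V → ℂ} {G : FGerm V} {v : V} (hv : v ≠ 0)
    (h : HasGen (diffOp v f) G) : ∃ F, HasGen f F := by
  obtain ⟨E, hE⟩ := exists_oneSubExp_mul_eq_one hv
  exact ⟨E * G, h.of_diffOp hv (by rw [← mul_assoc, hE, one_mul])⟩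

/-- A function which is invariant under a nonzero translation has generating function `0`. -/
theorem HasGen.zero_of_periodic {f : V → ℂ} {v : V} (hv : v ≠ 0) (h : ∀ x, f (x - v) = f x) :
    HasGen f 0 := by
  refine HasGen.of_diffOp hv (G := 0) ?_ (mul_zero _)
  rw [show diffOp v f = 0 from funext fun x => by simp [diffOp_apply, h]]
  exact HasGen.zero

/-- The generating function takes, near `0` and off finitely many hyperplanes, the value of the
exponential sum wherever this sum converges. -/
theorem HasGen.eventually_eq_of_hasSum {f : V → ℂ} {g : CDual V → ℂ} (h : HasGen f (g : FGerm V)) :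
    ∀ᶠ ξ in nearZero V, ∀ z, HasSum (fun x => f x * Complex.exp (ξ x)) z → g ξ = z := by
  obtain ⟨w, hw, h1, h2⟩ := h
  have h3 : ∀ᶠ ξ in nearZero V, (w.map fun v => 1 - Complex.exp (ξ v)).prod ≠ 0 := by
    clear h1 h2
    induction w with
    | nil => simp
    | cons v w ih =>
      filter_upwards [eventually_one_sub_exp_ne_zero (hw v (by simp)),
        ih fun u hu => hw u (by simp [hu])] with ξ h1 h2
      rw [List.map_cons, List.prod_cons]
      exact mul_ne_zero h1 h2
  rw [← coe_prod_map, ← Filter.Germ.coe_mul, Filter.Germ.coe_eq] at h2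
  filter_upwards [h2, h3] with ξ h2 h3 z hz
  have h4 := (hasSum_diffOps hz w).unique (hasSum_expSum h1 ξ)
  rw [← h2] at h4
  exact (mul_left_cancel₀ h3 h4).symm

/-- The function `z / (1 - e^z)` extends analytically to `0`. -/
theorem exists_analyticAt_mul_one_sub_exp :
    ∃ T : ℂ → ℂ, AnalyticAt ℂ T 0 ∧ ∀ᶠ z in 𝓝 (0 : ℂ), T z * (1 - Complex.exp z) = z := by
  have hana : AnalyticAt ℂ (fun z => 1 - Complex.exp z) 0 :=
    analyticAt_const.sub analyticAt_cexp
  obtain ⟨p, hp⟩ := hana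
  have hds : AnalyticAt ℂ (dslope (fun z => 1 - Complex.exp z) 0) 0 :=
    ⟨_, hp.has_fpower_series_dslope_fslope⟩
  have h0 : dslope (fun z => 1 - Complex.exp z) 0 0 ≠ 0 := by
    rw [dslope_same]
    have : HasDerivAt (fun z => 1 - Complex.exp z) (-Complex.exp 0) 0 :=
      (Complex.hasDerivAt_exp 0).const_sub 1
    rw [this.deriv]
    simp
  refine ⟨_, hds.inv h0, ?_⟩
  filter_upwards [hds.continuousAt.eventually_ne h0] with z hz
  have h1 := sub_smul_dslope (fun z => 1 - Complex.exp z) 0 z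
  simp only [Complex.exp_zero, sub_self, sub_zero, smul_eq_mul] at h1
  rw [← h1]
  simp only [Pi.inv_apply]
  field_simp

theorem mem_meroLin_of_oneSubExp_mul {v : V} (hv : v ≠ 0) {F : FGerm V}
    (h : oneSubExp v * F ∈ MeroLin V) : F ∈ MeroLin V := by
  induction F using Filter.Germ.inductionOn with | _ f
  obtain ⟨N, w, φ, hw, hφ, hF⟩ := h
  obtain ⟨T, hT, hTe⟩ := exists_analyticAt_mul_one_sub_exp
  refine ⟨N + 1, Fin.cons v w, fun ξ => T (ξ v) * φ ξ, ?_, ?_, ?_⟩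
  · exact fun j => Fin.cases hv hw j
  · have : AnalyticAt ℂ T ((fun ξ : CDual V => ξ v) 0) := by simpa using hT
    exact (this.fun_comp (f := fun ξ : CDual V => ξ v) (analyticAt_dual_apply v 0)).mul hφ
  · rw [oneSubExp, ← Filter.Germ.coe_mul, Filter.Germ.coe_eq] at hF
    refine Filter.Germ.coe_eq.mpr ?_
    have hT' : ∀ᶠ ξ in 𝓝 (0 : CDual V), T (ξ v) * (1 - Complex.exp (ξ v)) = ξ v := by
      have : Tendsto (fun ξ : CDual V => ξ v) (𝓝 0) (𝓝 0) := by
        simpa using (continuous_dual_apply v).tendsto 0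
      exact this.eventually hTe
    filter_upwards [hF, hT'.filter_mono inf_le_left, eventually_apply_ne_zero hv,
      eventually_one_sub_exp_ne_zero hv] with ξ h1 h2 h3 h4
    rw [Fin.prod_univ_succ]
    simp only [Fin.cons_zero, Fin.cons_succ, Pi.mul_apply] at h1 ⊢
    rw [mul_div_mul_comm, ← h1, div_mul_eq_mul_div, eq_div_iff h3]
    conv_lhs => rw [← h2]
    ring

theorem HasGen.mem_meroLin {f : V → ℂ} {F : FGerm V} (h : HasGen f F) : F ∈ MeroLin V := by
  obtain ⟨w, hw, h1, h2⟩ := h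
  have h3 : (w.map oneSubExp).prod * F ∈ MeroLin V := by
    rw [h2]
    refine ⟨0, Fin.elim0, expSum (diffOps w f), fun j => j.elim0, ?_, by simp⟩
    have : expSum (diffOps w f) =
        fun ξ => ∑ x ∈ h1.toFinset, diffOps w f x * Complex.exp (ξ x) := by
      funext ξ
      refine tsum_eq_sum fun x hx => ?_
      rw [Set.Finite.mem_toFinset, Function.mem_support, not_not] at hx
      rw [hx, zero_mul]
    rw [this]
    exact Finset.analyticAt_fun_sum _ fun x _ =>
      analyticAt_const.mul (analyticAt_dual_apply x 0).cexp
  clear h1 h2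
  induction w with
  | nil => simpa using h3
  | cons v w ih =>
    rw [List.map_cons, List.prod_cons, mul_assoc] at h3
    exact ih (fun u hu => hw u (by simp [hu]))
      (mem_meroLin_of_oneSubExp_mul (hw v (by simp)) h3)

end Gen

/-! ### Finitely generated modules over affine semigroups -/

section Stanley

/-- A decreasing sequence of lower sets becomes stationary in a well-quasi-order; for `ℕ^n` this is
Dickson's lemma. -/
theorem exists_stationary_of_lowerSet {α : Type*} [Preorder α] [WellQuasiOrderedLE α]
    {D : ℕ → Set α} (hD : ∀ k, IsLowerSet (D k)) (hanti : Antitone D) :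
    ∃ K, ∀ k, K ≤ k → D k = D K := by
  by_contra! hcon
  have h1 : ∀ K, ∃ k, K ≤ k ∧ ∃ b, b ∈ D K ∧ b ∉ D k := by
    intro K
    obtain ⟨k, hk, hne⟩ := hcon K
    refine ⟨k, hk, ?_⟩
    by_contra! h
    exact hne ((hanti hk).antisymm h)
  choose k hk b hb hb' using h1
  set s : ℕ → ℕ := fun j => k^[j] 0 with hs
  have hsucc : ∀ j, s (j + 1) = k (s j) := fun j => Function.iterate_succ_apply' k j 0
  have hmono : Monotone s := monotone_nat_of_le_succ fun j => by
    rw [hsucc]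
    exact hk _
  obtain ⟨i, j, hij, hle⟩ := wellQuasiOrdered_le fun j => b (s j)
  refine hb' (s i) ?_
  rw [← hsucc]
  exact hanti (hmono (Nat.succ_le_of_lt hij)) (hD _ hle (hb (s j)))

/-- If `B` is the disjoint union of `A` and `B + v`, then the difference operator of `v` maps the
indicator function of `B` to that of `A`. -/
theorem diffOp_indicator {V : Type*} [AddCommGroup V] {A B : Set V} {v : V}
    (h1 : ∀ x, x ∈ B ↔ x ∈ A ∨ x - v ∈ B)
    (h2 : ∀ x ∈ A, x - v ∉ B) :
    diffOp v (B.indicator 1) = (A.indicator 1 : V → ℂ) := by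
  classical
  funext x
  rw [diffOp_apply, Set.indicator_apply, Set.indicator_apply, Set.indicator_apply]
  by_cases hA : x ∈ A
  · rw [if_pos ((h1 x).mpr (Or.inl hA)), if_neg (h2 x hA), if_pos hA]
    simp
  · by_cases hB : x - v ∈ B
    · rw [if_pos ((h1 x).mpr (Or.inr hB)), if_pos hB, if_neg hA]
      simp
    · rw [if_neg, if_neg hB, if_neg hA, sub_zero]
      rw [h1]
      tauto

variable {V : Type*} [NormedAddCommGroup V] [NormedSpace ℝ V]

theorem HasGen.exists_indicator_union {A B : Set V} (hAB : Disjoint A B)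
    (hA : ∃ F, HasGen (A.indicator 1) F) (hB : ∃ F, HasGen (B.indicator 1) F) :
    ∃ F, HasGen ((A ∪ B).indicator 1) F := by
  obtain ⟨F, hF⟩ := hA
  obtain ⟨G, hG⟩ := hB
  refine ⟨F + G, ?_⟩
  rw [Set.indicator_union_of_disjoint hAB]
  exact hF.add hG

/-- The injective image of a lower set of `ℕ^n` under `b ↦ e + ∑ b_i v_i` is a finite disjoint
union of translates of simplicial semigroups, and has a generating function. -/
theorem exists_hasGen_image_lowerSet {n : ℕ} (v : Fin n → V) (hv : ∀ i, v i ≠ 0) (e : V)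
    {D : Set (Fin n → ℕ)} (hD : IsLowerSet D)
    (hinj : Set.InjOn (fun b : Fin n → ℕ => e + ∑ i, b i • v i) D) :
    ∃ F, HasGen (((fun b : Fin n → ℕ => e + ∑ i, b i • v i) '' D).indicator 1) F := by
  induction n generalizing e with
  | zero =>
    refine ⟨_, HasGen.of_finite (Set.Finite.subset ?_ Set.support_indicator_subset)⟩
    exact (Set.toFinite D).image _
  | succ n ih =>
    set φ : (Fin (n + 1) → ℕ) → V := fun b => e + ∑ i, b i • v i with hφ
    -- the slices of `D` at the height `k` of the first coordinate
    set S : ℕ → Set (Fin n → ℕ) := fun k => {b | (Fin.cons k b : Fin (n + 1) → ℕ) ∈ D} with hS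
    set v' : Fin n → V := fun i => v i.succ
    have hcons : ∀ (k : ℕ) (b : Fin n → ℕ),
        φ (Fin.cons k b) = (e + k • v 0) + ∑ i, b i • v' i := by
      intro k b
      simp only [hφ, Fin.sum_univ_succ, Fin.cons_zero, Fin.cons_succ, add_assoc, v']
    have hcons_succ : ∀ (k : ℕ) (b : Fin n → ℕ),
        φ (Fin.cons (k + 1) b) - v 0 = φ (Fin.cons k b) := by
      intro k b
      rw [hcons, hcons, succ_nsmul]
      abel
    have hle : ∀ {k k' : ℕ} {b b' : Fin n → ℕ}, k ≤ k' → b ≤ b' →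
        (Fin.cons k b : Fin (n + 1) → ℕ) ≤ Fin.cons k' b' := by
      intro k k' b b' hk hb i
      refine Fin.cases ?_ (fun j => ?_) i
      · simpa using hk
      · simpa using hb j
    have hSl : ∀ k, IsLowerSet (S k) := fun k b b' hb h => hD (hle le_rfl hb) h
    have hSanti : Antitone S := fun k k' hk b hb => hD (hle hk le_rfl) hb
    obtain ⟨K, hK⟩ := exists_stationary_of_lowerSet hSl hSanti
    set A : ℕ → Set V := fun k => (fun b => φ (Fin.cons k b)) '' S k with hA
    set B : ℕ → Set V := fun k => {x | ∃ j b, k ≤ j ∧ b ∈ S j ∧ x = φ (Fin.cons j b)} with hB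
    have hinj' : ∀ {j k : ℕ} {b b' : Fin n → ℕ}, b ∈ S j → b' ∈ S k →
        φ (Fin.cons j b) = φ (Fin.cons k b') → j = k := by
      intro j k b b' hb hb' h
      have := hinj hb hb' h
      exact (Fin.cons_inj.mp this).1
    have hAgen : ∀ k, ∃ F, HasGen ((A k).indicator 1) F := by
      intro k
      have := ih v' (fun i => hv i.succ) (e + k • v 0) (hSl k) (by
        intro b hb b' hb' h
        have h' : φ (Fin.cons k b) = φ (Fin.cons k b') := by
          rw [hcons, hcons]
          exact h
        exact (Fin.cons_inj.mp (hinj hb hb' h')).2)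
      simpa only [hA, hcons] using this
    -- above the height `K` the slices are constant, so `B K` is the disjoint union of `A K` and
    -- `B K + v 0`
    have hBK : ∃ F, HasGen ((B K).indicator 1) F := by
      obtain ⟨G, hG⟩ := hAgen K
      refine HasGen.exists_of_diffOp (v := v 0) (hv 0) (G := G) ?_
      rw [diffOp_indicator (A := A K)]
      · exact hG
      · intro x
        constructor
        · rintro ⟨j, b, hj, hb, rfl⟩
          rcases hj.eq_or_lt with rfl | hlt
          · exact Or.inl ⟨b, hb, rfl⟩
          · obtain ⟨i, rfl⟩ : ∃ i, j = i + 1 := ⟨j - 1, by omega⟩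
            exact Or.inr ⟨i, b, by omega, hSanti (Nat.le_succ i) hb, hcons_succ i b⟩
        · rintro (⟨b, hb, rfl⟩ | ⟨j, b, hj, hb, hx⟩)
          · exact ⟨K, b, le_rfl, hb, rfl⟩
          · refine ⟨j + 1, b, by omega, ?_, ?_⟩
            · rwa [hK (j + 1) (by omega), ← hK j hj]
            · rw [sub_eq_iff_eq_add.mp hx, ← hcons_succ, sub_add_cancel]
      · rintro _ ⟨b, hb, rfl⟩ ⟨j, b', hj, hb', hx⟩
        have hb'' : b' ∈ S (j + 1) := by rwa [hK (j + 1) (by omega), ← hK j hj]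
        have := hinj' hb hb'' (by
          have hx' := sub_eq_iff_eq_add.mp hx
          simp only at hx'
          rw [hx', ← hcons_succ, sub_add_cancel])
        omega
    have hBall : ∀ i, i ≤ K → ∃ F, HasGen ((B (K - i)).indicator 1) F := by
      intro i
      induction i with
      | zero => exact fun _ => hBK
      | succ i ih' =>
        intro hi
        have h1 : B (K - (i + 1)) = A (K - (i + 1)) ∪ B (K - i) := by
          ext x
          constructor
          · rintro ⟨j, b, hj, hb, rfl⟩
            rcases hj.eq_or_lt with rfl | hlt
            · exact Or.inl ⟨b, hb, rfl⟩
            · exact Or.inr ⟨j, b, by omega, hb, rfl⟩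
          · rintro (⟨b, hb, rfl⟩ | ⟨j, b, hj, hb, rfl⟩)
            · exact ⟨_, b, le_rfl, hb, rfl⟩
            · exact ⟨j, b, by omega, hb, rfl⟩
        rw [h1]
        refine HasGen.exists_indicator_union ?_ (hAgen _) (ih' (by omega))
        refine Set.disjoint_left.mpr ?_
        rintro _ ⟨b, hb, rfl⟩ ⟨j, b', hj, hb', hx⟩
        have := hinj' hb hb' hx
        omega
    have hBD : B (K - K) = φ '' D := by
      ext x
      constructor
      · rintro ⟨j, b, -, hb, rfl⟩
        exact ⟨_, hb, rfl⟩
      · rintro ⟨b, hb, rfl⟩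
        refine ⟨b 0, Fin.tail b, by omega, ?_, ?_⟩
        · simpa [hS] using hb
        · rw [Fin.cons_self_tail]
    rw [← hBD]
    exact hBall K le_rfl

/-- The indicator function of `E + ∑ ℕ v_i`, with `E` finite, has a generating function. The points
of `e + ∑ ℕ v_i` are parametrised by the lexicographically smallest coefficient vectors; these,
and those among them which do not give a point already counted, form a lower set. -/
theorem exists_hasGen_semigroup {n : ℕ} (v : Fin n → V) (hv : ∀ i, v i ≠ 0) (E : Finset V) :
    ∃ F, HasGen ({x | ∃ e ∈ E, ∃ b : Fin n → ℕ, x = e + ∑ i, b i • v i}.indicator 1) F := by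
  classical
  induction E using Finset.induction_on with
  | empty =>
    refine ⟨0, ?_⟩
    simp only [Finset.notMem_empty, false_and, exists_false, Set.ofPred_false,
      Set.indicator_empty]
    exact HasGen.zero
  | insert e E he ih =>
    set A : Set V := {x | ∃ e ∈ E, ∃ b : Fin n → ℕ, x = e + ∑ i, b i • v i} with hA
    set φ : (Fin n → ℕ) → V := fun b => e + ∑ i, b i • v i with hφ
    have hφadd : ∀ b c, φ (b + c) = φ b + ∑ i, c i • v i := by
      intro b c
      simp only [hφ, Pi.add_apply, add_smul, Finset.sum_add_distrib, add_assoc]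
    -- the lexicographically smallest coefficient vectors of the points of `e + ∑ ℕ v_i` not in `A`
    set D : Set (Fin n → ℕ) := {b | φ b ∉ A ∧ ∀ b', φ b' = φ b → toLex b ≤ toLex b'} with hDdef
    have hD : IsLowerSet D := by
      intro b b' hb hbD
      obtain ⟨c, rfl⟩ : ∃ c, b = b' + c := ⟨b - b', (add_tsub_cancel_of_le hb).symm⟩
      refine ⟨?_, fun b'' h => ?_⟩
      · rintro ⟨e', he', a, ha⟩
        refine hbD.1 ⟨e', he', a + c, ?_⟩
        rw [hφadd, ha]
        simp only [Pi.add_apply, add_smul, Finset.sum_add_distrib, add_assoc]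
      · have := hbD.2 (b'' + c) (by rw [hφadd, hφadd, h])
        rw [toLex_add, toLex_add] at this
        exact le_of_add_le_add_right this
    have hinj : Set.InjOn φ D := fun b hb b' hb' h =>
      toLex.injective (le_antisymm (hb.2 b' h.symm) (hb'.2 b h))
    have hset : {x | ∃ e' ∈ insert e E, ∃ b : Fin n → ℕ, x = e' + ∑ i, b i • v i} =
        A ∪ φ '' D := by
      ext x
      constructor
      · rintro ⟨e', he', b, rfl⟩
        by_cases hx : e' + ∑ i, b i • v i ∈ A
        · exact Or.inl hx
        rcases Finset.mem_insert.mp he' with rfl | he'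
        · right
          obtain ⟨m, hm, hmin⟩ := WellFounded.has_min
            (wellFounded_lt : WellFounded fun x y : Lex (Fin n → ℕ) => x < y)
            {c | φ (ofLex c) = φ b} ⟨toLex b, rfl⟩
          refine ⟨ofLex m, ⟨?_, fun b' hb' => ?_⟩, hm⟩
          · rw [hm]
            exact hx
          · exact not_lt.mp (hmin (toLex b') (hb'.trans hm))
        · exact absurd ⟨e', he', b, rfl⟩ hx
      · rintro (⟨e', he', b, rfl⟩ | ⟨b, -, rfl⟩)
        · exact ⟨e', Finset.mem_insert_of_mem he', b, rfl⟩
        · exact ⟨e, Finset.mem_insert_self e E, b, rfl⟩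
    rw [hset]
    refine HasGen.exists_indicator_union ?_ ih (exists_hasGen_image_lowerSet v hv e hD hinj)
    refine Set.disjoint_left.mpr ?_
    rintro _ hx ⟨b, hb, rfl⟩
    exact hb.1 hx

theorem mem_hull_range_iff {n : ℕ} {v : Fin n → V} {x : V} :
    x ∈ PointedCone.hull ℝ (Set.range v) ↔
      ∃ t : Fin n → ℝ, (∀ i, 0 ≤ t i) ∧ x = ∑ i, t i • v i := by
  rw [PointedCone.hull, Submodule.mem_span_range_iff_exists_fun]
  constructor
  · rintro ⟨t, rfl⟩
    exact ⟨fun i => t i, fun i => (t i).2, rfl⟩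
  · rintro ⟨t, ht, rfl⟩
    exact ⟨fun i => ⟨t i, ht i⟩, rfl⟩

/-- Rational cones have generators which are nonzero lattice vectors. -/
theorem IsRationalCone.exists_generators {Λ : Submodule ℤ V} {c : PointedCone ℝ V}
    (hc : IsRationalCone Λ c) : ∃ (n : ℕ) (v : Fin n → V), (∀ i, v i ≠ 0) ∧ (∀ i, v i ∈ Λ) ∧
      c = PointedCone.hull ℝ (Set.range v) := by
  classical
  obtain ⟨T, hT, rfl⟩ := hc
  have hmem : ∀ i, (((T.erase 0).equivFin.symm i : T.erase 0) : V) ∈ T.erase 0 :=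
    fun i => ((T.erase 0).equivFin.symm i).2
  refine ⟨(T.erase 0).card, fun i => ((T.erase 0).equivFin.symm i : T.erase 0),
    fun i => Finset.ne_of_mem_erase (hmem i), fun i => hT _ (Finset.mem_of_mem_erase (hmem i)), ?_⟩
  have : (Set.range fun i => (((T.erase 0).equivFin.symm i : T.erase 0) : V)) =
      (T : Set V) \ {0} := by
    ext x
    constructor
    · rintro ⟨i, rfl⟩
      exact ⟨Finset.mem_of_mem_erase (hmem i), Finset.ne_of_mem_erase (hmem i)⟩
    · rintro ⟨h1, h2⟩
      refine ⟨(T.erase 0).equivFin ⟨x, Finset.mem_erase.mpr ⟨h2, h1⟩⟩, by simp⟩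
  rw [this, PointedCone.hull, PointedCone.hull, Submodule.span_sdiff_singleton_zero]

theorem mem_vadd_iff_sub_mem {c : PointedCone ℝ V} {s x : V} :
    x ∈ s +ᵥ (c : Set V) ↔ x - s ∈ c := by
  rw [Set.mem_vadd_set_iff_neg_vadd_mem, vadd_eq_add, neg_add_eq_sub]
  rfl

/-- The indicator function of the lattice points of a set. -/
def latticeIndicator (Λ : Submodule ℤ V) (p : Set V) : V → ℂ := {x | x ∈ p ∧ x ∈ Λ}.indicator 1

/-- The lattice points of a shifted rational cone have a generating function: they are finitely
many translates of the semigroup spanned by the generators. -/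
theorem exists_hasGen_cone [FiniteDimensional ℝ V] (Λ : Submodule ℤ V) [DiscreteTopology Λ]
    {c : PointedCone ℝ V} (hc : IsRationalCone Λ c) (s : V) :
    ∃ F, HasGen (latticeIndicator Λ (s +ᵥ (c : Set V))) F := by
  obtain ⟨n, v, hv0, hvΛ, rfl⟩ := hc.exists_generators
  have hfin : (Metric.closedBall s (∑ i, ‖v i‖) ∩ (Λ : Set V)).Finite := by
    have : DiscreteTopology Λ.toAddSubgroup := inferInstanceAs (DiscreteTopology Λ)
    have hcl : IsClosed (Λ : Set V) := AddSubgroup.isClosed_of_discrete (H := Λ.toAddSubgroup)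
    exact Metric.finite_isBounded_inter_isClosed
      (isDiscrete_iff_discreteTopology.mpr ‹DiscreteTopology Λ›) Metric.isBounded_closedBall hcl
  classical
  set E : Finset V := hfin.toFinset.filter
    (· - s ∈ PointedCone.hull ℝ (Set.range v)) with hE
  have hset : {x | x ∈ s +ᵥ ((PointedCone.hull ℝ (Set.range v) : PointedCone ℝ V) : Set V) ∧
      x ∈ Λ} =
      {x | ∃ e ∈ E, ∃ b : Fin n → ℕ, x = e + ∑ i, b i • v i} := by
    ext x
    simp only [Set.mem_ofPred_eq, mem_vadd_iff_sub_mem]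
    constructor
    · rintro ⟨hx, hxΛ⟩
      obtain ⟨t, ht, hxt⟩ := mem_hull_range_iff.mp hx
      have key : x - ∑ i, ⌊t i⌋₊ • v i - s = ∑ i, Int.fract (t i) • v i := by
        rw [sub_right_comm, hxt, ← Finset.sum_sub_distrib]
        refine Finset.sum_congr rfl fun i _ => ?_
        rw [← Nat.cast_smul_eq_nsmul ℝ, ← sub_smul, natCast_floor_eq_intCast_floor (ht i)]
        rfl
      -- rounding the coefficients down leaves a lattice point at bounded distance from `s`
      refine ⟨x - ∑ i, ⌊t i⌋₊ • v i, ?_, fun i => ⌊t i⌋₊, by abel⟩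
      rw [hE, Finset.mem_filter, Set.Finite.mem_toFinset, key]
      refine ⟨⟨?_, ?_⟩, mem_hull_range_iff.mpr ⟨_, fun i => Int.fract_nonneg _, rfl⟩⟩
      · rw [mem_closedBall_iff_norm, key]
        refine (norm_sum_le _ _).trans (Finset.sum_le_sum fun i _ => ?_)
        rw [norm_smul, Real.norm_of_nonneg (Int.fract_nonneg _)]
        exact mul_le_of_le_one_left (norm_nonneg _) (Int.fract_lt_one _).le
      · exact Λ.sub_mem hxΛ (Λ.sum_mem fun i _ => Λ.toAddSubmonoid.nsmul_mem (hvΛ i) _)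
    · rintro ⟨e, he, b, rfl⟩
      rw [hE, Finset.mem_filter, Set.Finite.mem_toFinset] at he
      refine ⟨?_, Λ.add_mem he.1.2 (Λ.sum_mem fun i _ => Λ.toAddSubmonoid.nsmul_mem (hvΛ i) _)⟩
      rw [add_sub_right_comm]
      refine Submodule.add_mem _ he.2 (Submodule.sum_mem _ fun i _ => ?_)
      exact AddSubmonoid.nsmul_mem (Submodule.toAddSubmonoid _)
        (PointedCone.subset_hull (Set.mem_range_self i)) _
  rw [latticeIndicator, hset]
  exact exists_hasGen_semigroup v hv0 E

end Stanley

/-! ### Cones with and without lines -/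

section Geometry

variable {V : Type*} [NormedAddCommGroup V] [NormedSpace ℝ V] {n : ℕ}

/-- The forms whose real part is negative on the vectors `v i`: the domain of convergence of the
generating functions of the cone spanned by these vectors. -/
def convDomain (v : Fin n → V) : Set (CDual V) := {ξ | ∀ i, (ξ (v i)).re < 0}

theorem isOpen_convDomain (v : Fin n → V) : IsOpen (convDomain v) := by
  rw [convDomain, Set.ofPred_forall]
  exact isOpen_iInter_of_finite fun i =>
    isOpen_lt (Complex.continuous_re.comp (continuous_dual_apply (v i))) continuous_const

theorem smul_mem_convDomain {v : Fin n → V} {ξ : CDual V} (hξ : ξ ∈ convDomain v) {t : ℝ}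
    (ht : 0 < t) : (t : ℂ) • ξ ∈ convDomain v := by
  intro i
  rw [_root_.smul_apply, smul_eq_mul, Complex.re_ofReal_mul]
  exact mul_neg_of_pos_of_neg ht (hξ i)

/-- A real linear form, as an element of `V*_ℂ`. -/
def realForm (l : V →L[ℝ] ℝ) : CDual V := Complex.ofRealCLM.comp l

@[simp] theorem realForm_apply (l : V →L[ℝ] ℝ) (x : V) : realForm l x = (l x : ℂ) := rfl

/-- A finitely generated cone contains the line through one of its generators, or there is a linear
form which is negative on all generators. -/
theorem neg_mem_hull_or_exists_form (v : Fin n → V) :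
    (∃ i, -v i ∈ PointedCone.hull ℝ (Set.range v)) ∨
      ∃ l : V →L[ℝ] ℝ, realForm l ∈ convDomain v := by
  by_cases h0 : (0 : V) ∈ convexHull ℝ (Set.range v)
  · -- a convex combination of generators which is `0` exhibits the negative of a generator
    left
    rw [convexHull_range_eq_exists_affineCombination] at h0
    obtain ⟨s, w, hw, hw1, hw2⟩ := h0
    rw [Finset.affineCombination_eq_linear_combination _ _ _ hw1] at hw2
    obtain ⟨i, hi, hpos⟩ : ∃ i ∈ s, 0 < w i := by
      by_contra! hcon
      have : ∑ i ∈ s, w i ≤ 0 := Finset.sum_nonpos hcon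
      linarith
    refine ⟨i, ?_⟩
    have h1 : -v i = ∑ j ∈ s.erase i, (w j / w i) • v j := by
      rw [← Finset.add_sum_erase s _ hi] at hw2
      have h2 : w i • v i = -∑ j ∈ s.erase i, w j • v j := eq_neg_of_add_eq_zero_left hw2
      have h3 : v i = -∑ j ∈ s.erase i, (w j / w i) • v j := by
        rw [← inv_smul_smul₀ hpos.ne' (v i), h2, smul_neg, Finset.smul_sum]
        congr 1
        refine Finset.sum_congr rfl fun j _ => ?_
        rw [smul_smul, div_eq_inv_mul]
      rw [neg_eq_iff_eq_neg]
      exact h3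
    rw [h1]
    refine Submodule.sum_mem _ fun j hj => ?_
    exact PointedCone.smul_mem _ (div_nonneg (hw j (Finset.mem_of_mem_erase hj)) hpos.le)
      (PointedCone.subset_hull (Set.mem_range_self j))
  · -- otherwise `0` can be separated strictly from the convex hull of the generators
    right
    obtain ⟨f, u, hu, hf⟩ := geometric_hahn_banach_point_closed (convex_convexHull ℝ (Set.range v))
      ((Set.finite_range v).isCompact_convexHull ℝ).isClosed h0
    rw [map_zero] at hu
    refine ⟨-f, fun i => ?_⟩
    have := hf (v i) (subset_convexHull ℝ _ (Set.mem_range_self i))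
    rw [realForm_apply, Complex.ofReal_re, _root_.neg_apply]
    linarith

/-- On the cone spanned by the `v i`, the norm is controlled by the real part of every form of the
domain of convergence. -/
theorem exists_norm_le_of_mem_convDomain {v : Fin n → V} {ξ : CDual V} (hξ : ξ ∈ convDomain v) :
    ∃ C : ℝ, 0 < C ∧ ∀ y ∈ PointedCone.hull ℝ (Set.range v), ‖y‖ ≤ C * -(ξ y).re := by
  refine ⟨∑ i, ‖v i‖ / -(ξ (v i)).re + 1, ?_, fun y hy => ?_⟩
  · have : 0 ≤ ∑ i, ‖v i‖ / -(ξ (v i)).re := Finset.sum_nonneg fun i _ =>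
      div_nonneg (norm_nonneg _) (by linarith [hξ i])
    linarith
  · obtain ⟨t, ht, rfl⟩ := mem_hull_range_iff.mp hy
    have h1 : -(ξ (∑ i, t i • v i)).re = ∑ i, t i * -(ξ (v i)).re := by
      simp only [map_sum, Complex.re_sum, map_smul, Complex.real_smul, Complex.re_ofReal_mul,
        mul_neg, Finset.sum_neg_distrib]
    rw [h1, Finset.mul_sum]
    refine (norm_sum_le _ _).trans (Finset.sum_le_sum fun i _ => ?_)
    rw [norm_smul, Real.norm_of_nonneg (ht i)]
    have hneg : 0 < -(ξ (v i)).re := by linarith [hξ i]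
    have h2 : ‖v i‖ / -(ξ (v i)).re ≤ ∑ i, ‖v i‖ / -(ξ (v i)).re + 1 := by
      have := Finset.single_le_sum (f := fun i => ‖v i‖ / -(ξ (v i)).re)
        (fun j _ => div_nonneg (norm_nonneg _) (by linarith [hξ j])) (Finset.mem_univ i)
      linarith
    rw [div_le_iff₀ hneg] at h2
    calc t i * ‖v i‖ ≤ t i * ((∑ i, ‖v i‖ / -(ξ (v i)).re + 1) * -(ξ (v i)).re) :=
          mul_le_mul_of_nonneg_left h2 (ht i)
      _ = _ := by ring

theorem not_containsLine {v : Fin n → V} {ξ : CDual V} (hξ : ξ ∈ convDomain v) (s : V) :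
    ¬ ContainsLine (s +ᵥ ((PointedCone.hull ℝ (Set.range v) : PointedCone ℝ V) : Set V)) := by
  rintro ⟨x, w, hw, hline⟩
  obtain ⟨C, hC, hb⟩ := exists_norm_le_of_mem_convDomain hξ
  have h1 : ∀ t : ℝ, ‖x - s + t • w‖ ≤ C * (-(ξ (x - s)).re - t * (ξ w).re) := by
    intro t
    have h := hb _ (mem_vadd_iff_sub_mem.mp (hline t))
    rw [add_sub_right_comm, map_add, map_smul, Complex.add_re, Complex.real_smul,
      Complex.re_ofReal_mul] at h
    rw [show -(ξ (x - s)).re - t * (ξ w).re = -((ξ (x - s)).re + t * (ξ w).re) by ring]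
    exact h
  rcases eq_or_ne (ξ w).re 0 with h0 | h0
  · have h2 := h1 ((C * -(ξ (x - s)).re + ‖x - s‖ + 1) / ‖w‖)
    have hwn : 0 < ‖w‖ := norm_pos_iff.mpr hw
    have h3 : (0 : ℝ) ≤ C * -(ξ (x - s)).re := by
      have := h1 0
      simp only [zero_smul, zero_mul, add_zero, sub_zero] at this
      exact (norm_nonneg _).trans this
    have h4 := norm_sub_le (x - s + ((C * -(ξ (x - s)).re + ‖x - s‖ + 1) / ‖w‖) • w) (x - s)
    rw [add_sub_cancel_left, norm_smul, Real.norm_of_nonneg (by positivity),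
      div_mul_cancel₀ _ hwn.ne'] at h4
    rw [h0, mul_zero, sub_zero] at h2
    linarith
  · have h2 := (norm_nonneg _).trans (h1 ((-(ξ (x - s)).re + 1) / (ξ w).re))
    rw [div_mul_cancel₀ _ h0] at h2
    nlinarith

theorem containsLine_vadd {v : Fin n → V} {i : Fin n} (hv : v i ≠ 0)
    (hi : -v i ∈ PointedCone.hull ℝ (Set.range v)) (s : V) :
    ContainsLine (s +ᵥ ((PointedCone.hull ℝ (Set.range v) : PointedCone ℝ V) : Set V)) := by
  refine ⟨s, v i, hv, fun t => mem_vadd_iff_sub_mem.mpr ?_⟩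
  rw [add_sub_cancel_left]
  rcases le_total 0 t with ht | ht
  · exact PointedCone.smul_mem _ ht (PointedCone.subset_hull (Set.mem_range_self i))
  · rw [← neg_smul_neg]
    exact PointedCone.smul_mem _ (neg_nonneg.mpr ht) hi

/-- The lattice points of a shifted cone which contains the line through a generator are invariant
under translation by this generator. -/
theorem hasGen_zero_of_neg_mem {Λ : Submodule ℤ V} {v : Fin n → V} {i : Fin n} (hv : v i ≠ 0)
    (hΛ : v i ∈ Λ) (hi : -v i ∈ PointedCone.hull ℝ (Set.range v)) (s : V) :
    HasGen (latticeIndicator Λ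
      (s +ᵥ ((PointedCone.hull ℝ (Set.range v) : PointedCone ℝ V) : Set V))) 0 := by
  classical
  refine HasGen.zero_of_periodic hv fun x => ?_
  have h1 : x - v i ∈ Λ ↔ x ∈ Λ := Submodule.sub_mem_iff_left Λ hΛ
  have h2 : x - v i - s ∈ PointedCone.hull ℝ (Set.range v) ↔
      x - s ∈ PointedCone.hull ℝ (Set.range v) := by
    rw [sub_right_comm]
    constructor
    · intro h
      have := Submodule.add_mem _ h (PointedCone.subset_hull (R := ℝ) (Set.mem_range_self i))
      rwa [sub_add_cancel] at this
    · intro h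
      have := Submodule.add_mem _ h hi
      rwa [← sub_eq_add_neg] at this
  simp only [latticeIndicator, Set.indicator_apply, Set.mem_ofPred_eq, mem_vadd_iff_sub_mem, h1, h2,
    Pi.one_apply]

end Geometry

/-! ### Lattice sums as integrals, and their Riemann limits -/

section Rescaling

variable {V : Type*} [NormedAddCommGroup V] [NormedSpace ℝ V] {Λ : Submodule ℤ V}

theorem hasSum_latticeIndicator_iff {p : Set V} {ξ : CDual V} {z : ℂ} :
    HasSum (fun x => latticeIndicator Λ p x * Complex.exp (ξ x)) z ↔
      HasSum (fun x : {x : V // x ∈ p ∧ x ∈ Λ} => Complex.exp (ξ x.1)) z := by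
  classical
  have h := hasSum_subtype_iff_indicator (s := {x | x ∈ p ∧ x ∈ Λ})
    (f := fun x : V => Complex.exp (ξ x)) (a := z)
  refine Iff.trans (iff_of_eq (congrArg (fun f => HasSum f z) ?_)) h.symm
  funext x
  rw [latticeIndicator, Set.indicator_apply, Set.indicator_apply]
  split_ifs <;> simp

/-- The step function `z ↦ [p](x) e^{τ⟨ξ,x⟩}`, where `x` is the lattice point to which `z / τ` is
rounded by `r`. -/
def rescaledStep (r : V → Λ) (p : Set V) (ξ : CDual V) (τ : ℝ) (z : V) : ℂ :=
  p.indicator (fun x => Complex.exp (τ * ξ x)) (r (τ⁻¹ • z))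

/-- Pointwise convergence as `τ → 0⁺`, off the boundary of the cone. -/
theorem tendsto_rescaledStep {r : V → Λ} {R : ℝ} (hR : ∀ z, ‖z - (r z : V)‖ ≤ R)
    (c : PointedCone ℝ V) (ξ : CDual V) (s : V) {z : V} (hz : z ∉ frontier (c : Set V)) :
    Tendsto (fun τ : ℝ => rescaledStep r (s +ᵥ (c : Set V)) ξ τ z) (𝓝[>] 0)
      (𝓝 ((c : Set V).indicator (fun x => Complex.exp (ξ x)) z)) := by
  classical
  have hid : Tendsto (fun τ : ℝ => τ) (𝓝[>] 0) (𝓝 0) := tendsto_id.mono_left nhdsWithin_le_nhds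
  have h1 : Tendsto (fun τ : ℝ => τ • (r (τ⁻¹ • z) : V)) (𝓝[>] 0) (𝓝 z) := by
    rw [tendsto_iff_norm_sub_tendsto_zero]
    refine squeeze_zero' (Filter.Eventually.of_forall fun _ => norm_nonneg _) ?_
      (by simpa using hid.mul_const R)
    filter_upwards [self_mem_nhdsWithin] with τ hτ
    have hτ : 0 < τ := hτ
    calc ‖τ • (r (τ⁻¹ • z) : V) - z‖ = ‖τ • (τ⁻¹ • z - (r (τ⁻¹ • z) : V))‖ := by
          rw [smul_sub, smul_inv_smul₀ hτ.ne', norm_sub_rev]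
      _ ≤ τ * R := by
          rw [norm_smul, Real.norm_of_nonneg hτ.le]
          exact mul_le_mul_of_nonneg_left (hR _) hτ.le
  have h2 : Tendsto (fun τ : ℝ => τ • ((r (τ⁻¹ • z) : V) - s)) (𝓝[>] 0) (𝓝 z) := by
    have := h1.sub (hid.smul_const s)
    simpa [smul_sub] using this
  have h3 : ∀ τ : ℝ, 0 < τ → ((r (τ⁻¹ • z) : V) ∈ s +ᵥ (c : Set V) ↔
      τ • ((r (τ⁻¹ • z) : V) - s) ∈ (c : Set V)) := fun τ hτ => by
    rw [mem_vadd_iff_sub_mem, SetLike.mem_coe, c.smul_mem_iff hτ]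
  by_cases hzc : z ∈ interior (c : Set V)
  · rw [Set.indicator_of_mem (interior_subset hzc)]
    have h4 : Tendsto (fun τ : ℝ => Complex.exp (ξ (τ • (r (τ⁻¹ • z) : V)))) (𝓝[>] 0)
        (𝓝 (Complex.exp (ξ z))) :=
      ((Complex.continuous_exp.comp ξ.continuous).tendsto z).comp h1
    refine h4.congr' ?_
    filter_upwards [h2.eventually (isOpen_interior.mem_nhds hzc), self_mem_nhdsWithin] with τ h5 h6
    rw [rescaledStep, Set.indicator_of_mem ((h3 τ h6).mpr (interior_subset h5)), map_smul,
      Complex.real_smul]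
  · have hzcl : z ∉ closure (c : Set V) := fun h => hz ⟨h, hzc⟩
    rw [Set.indicator_of_notMem fun h => hzcl (subset_closure h)]
    refine tendsto_const_nhds.congr' ?_
    filter_upwards [h2.eventually (isClosed_closure.isOpen_compl.mem_nhds hzcl),
      self_mem_nhdsWithin] with τ h5 h6
    rw [rescaledStep, Set.indicator_of_notMem]
    rw [h3 τ h6]
    exact fun h => h5 (subset_closure h)

/-- A bound independent of `τ`, for dominated convergence: on the cone, `Re ⟨ξ,y⟩ ≤ -δ ‖y‖`. -/
theorem exists_bound_rescaledStep {n : ℕ} {v : Fin n → V} {r : V → Λ} {R : ℝ}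
    (hR : ∀ z, ‖z - (r z : V)‖ ≤ R) {ξ : CDual V} (hξ : ξ ∈ convDomain v) (s : V) :
    ∃ K δ : ℝ, 0 < δ ∧ ∀ τ : ℝ, 0 < τ → τ ≤ 1 → ∀ z,
      ‖rescaledStep r (s +ᵥ ((PointedCone.hull ℝ (Set.range v) : PointedCone ℝ V) : Set V)) ξ τ z‖ ≤
        Real.exp K * Real.exp (-δ * ‖z‖) := by
  obtain ⟨C, hC, hb⟩ := exists_norm_le_of_mem_convDomain hξ
  refine ⟨‖ξ s‖ + C⁻¹ * (R + ‖s‖), C⁻¹, by positivity, fun τ hτ hτ1 z => ?_⟩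
  by_cases hx : (r (τ⁻¹ • z) : V) ∈
      s +ᵥ ((PointedCone.hull ℝ (Set.range v) : PointedCone ℝ V) : Set V)
  · rw [rescaledStep, Set.indicator_of_mem hx, Complex.norm_exp, Complex.re_ofReal_mul,
      ← Real.exp_add]
    refine Real.exp_le_exp.mpr ?_
    set x : V := (r (τ⁻¹ • z) : V) with hxdef
    have h1 : C⁻¹ * ‖x - s‖ ≤ -(ξ (x - s)).re := by
      rw [inv_mul_le_iff₀ hC]
      exact hb _ (mem_vadd_iff_sub_mem.mp hx)
    have h2 : ‖z‖ ≤ τ * (R + ‖s‖) + τ * ‖x - s‖ := by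
      have h3 : z = τ • ((τ⁻¹ • z - x) + s + (x - s)) := by
        rw [show (τ⁻¹ • z - x) + s + (x - s) = τ⁻¹ • z by abel, smul_inv_smul₀ hτ.ne']
      calc ‖z‖ = τ * ‖(τ⁻¹ • z - x) + s + (x - s)‖ := by
            conv_lhs => rw [h3]
            rw [norm_smul, Real.norm_of_nonneg hτ.le]
        _ ≤ τ * (R + ‖s‖ + ‖x - s‖) := by
            refine mul_le_mul_of_nonneg_left ((norm_add_le _ _).trans ?_) hτ.le
            exact add_le_add_left ((norm_add_le _ _).trans (add_le_add_left (hR _) _)) _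
        _ = _ := by ring
    have h4 : (ξ x).re = (ξ s).re + (ξ (x - s)).re := by
      rw [← Complex.add_re, ← map_add, add_sub_cancel]
    have h5 : (ξ s).re ≤ ‖ξ s‖ := Complex.re_le_norm _
    have hR0 : 0 ≤ R + ‖s‖ := add_nonneg ((norm_nonneg _).trans (hR 0)) (norm_nonneg _)
    have hCi : 0 < C⁻¹ := by positivity
    have h6 : τ * (ξ x).re ≤ τ * ‖ξ s‖ - τ * (C⁻¹ * ‖x - s‖) := by
      rw [h4, ← mul_sub]
      exact mul_le_mul_of_nonneg_left (by linarith) hτ.le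
    have h7 : τ * ‖ξ s‖ ≤ ‖ξ s‖ := mul_le_of_le_one_left (norm_nonneg _) hτ1
    have h8 : τ * (C⁻¹ * (R + ‖s‖)) ≤ C⁻¹ * (R + ‖s‖) :=
      mul_le_of_le_one_left (by positivity) hτ1
    have h9 := mul_le_mul_of_nonneg_left h2 hCi.le
    nlinarith
  · rw [rescaledStep, Set.indicator_of_notMem hx, norm_zero]
    positivity

end Rescaling

section Riemann

variable {V : Type*} [NormedAddCommGroup V] [NormedSpace ℝ V] [FiniteDimensional ℝ V]
  [MeasurableSpace V] [BorelSpace V]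

instance isAddHaarMeasure_latticeMeasure (Λ : Submodule ℤ V) [DiscreteTopology Λ]
    [IsZLattice ℝ Λ] : (latticeMeasure Λ).IsAddHaarMeasure := by
  have := ZLattice.module_free ℝ Λ
  exact inferInstanceAs
    (((Module.Free.chooseBasis ℤ Λ).ofZLatticeBasis ℝ Λ).addHaar).IsAddHaarMeasure

/-- Rounding down to the lattice, with respect to a basis: a measurable map which moves points by a
bounded amount, and whose fibres have measure `1`. -/
theorem exists_lattice_floor (Λ : Submodule ℤ V) [DiscreteTopology Λ] [IsZLattice ℝ Λ] :
    ∃ (r : V → Λ) (R : ℝ), 0 ≤ R ∧ Measurable r ∧ (∀ z, ‖z - (r z : V)‖ ≤ R) ∧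
      ∀ x : Λ, latticeMeasure Λ (r ⁻¹' {x}) = 1 := by
  have := ZLattice.module_free ℝ Λ
  set b := (Module.Free.chooseBasis ℤ Λ).ofZLatticeBasis ℝ Λ with hb
  have hspan : Submodule.span ℤ (Set.range b) = Λ :=
    Module.Basis.ofZLatticeBasis_span ℝ Λ (Module.Free.chooseBasis ℤ Λ)
  have hμ : latticeMeasure Λ = b.addHaar := rfl
  have hfl : ∀ z, ((ZSpan.floor b z : Submodule.span ℤ (Set.range b)) : V) ∈ Λ := fun z =>
    hspan.le (ZSpan.floor b z).2
  have hunit : latticeMeasure Λ (ZSpan.fundamentalDomain b) = 1 := by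
    rw [hμ, measure_congr (ZSpan.fundamentalDomain_ae_parallelepiped b b.addHaar), b.addHaar_self]
  refine ⟨fun z => ⟨ZSpan.floor b z, hfl z⟩, ∑ i, ‖b i‖, Finset.sum_nonneg fun i _ => norm_nonneg _,
    ?_, fun z => ZSpan.norm_fract_le b z, fun x => ?_⟩
  · refine Measurable.subtype_mk ?_
    have : (fun z => ((ZSpan.floor b z : Submodule.span ℤ (Set.range b)) : V)) =
        fun z => ∑ i, (⌊b.repr z i⌋ : ℝ) • b i := by
      funext z
      refine b.repr.injective (Finsupp.ext fun i => ?_)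
      rw [ZSpan.repr_floor_apply, b.repr_sum_self]
    rw [this]
    refine Finset.measurable_fun_sum _ fun i _ => Measurable.smul_const ?_ _
    refine measurable_from_top.comp (Int.measurable_floor.comp ?_)
    exact (LinearMap.continuous_of_finiteDimensional (b.coord i)).measurable
  · have hset : (fun z => (⟨ZSpan.floor b z, hfl z⟩ : Λ)) ⁻¹' {x} =
        (fun z => z + -(x : V)) ⁻¹' ZSpan.fundamentalDomain b := by
      ext z
      rw [Set.mem_preimage, Set.mem_singleton_iff, Set.mem_preimage, ← ZSpan.fract_eq_self]
      have hx : -(x : V) ∈ Submodule.span ℤ (Set.range b) := by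
        rw [hspan]
        exact Λ.neg_mem x.2
      rw [ZSpan.fract_add_ZSpan b z hx, ZSpan.fract_apply, Subtype.ext_iff, ← sub_eq_add_neg]
      exact ⟨fun h => by rw [← h], fun h => sub_right_injective h⟩
    rw [hset, measure_preimage_add_right, hunit]

/-- A sum over the lattice is the integral of the function rounded down to the lattice. -/
theorem hasSum_lattice_of_integrable {Λ : Submodule ℤ V} [DiscreteTopology Λ] [IsZLattice ℝ Λ]
    {r : V → Λ} (hr : Measurable r) (hr1 : ∀ x : Λ, latticeMeasure Λ (r ⁻¹' {x}) = 1)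
    {G : V → ℂ} (hG : Integrable (fun z => G (r z)) (latticeMeasure Λ)) :
    HasSum (fun x : Λ => G x) (∫ z, G (r z) ∂(latticeMeasure Λ)) := by
  have h := hasSum_integral_iUnion (μ := latticeMeasure Λ) (f := fun z => G (r z))
    (s := fun x : Λ => r ⁻¹' {x}) (fun x => hr (measurableSet_singleton x))
    (fun x y hxy => Set.disjoint_left.mpr fun z hz hz' => hxy (hz.symm.trans hz')) hG.integrableOn
  have hu : (⋃ x : Λ, r ⁻¹' {x}) = Set.univ := by
    ext z
    simp
  rw [hu, setIntegral_univ] at h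
  refine h.congr_fun fun x => ?_
  have h1 : ∫ z in r ⁻¹' {x}, G (r z) ∂(latticeMeasure Λ) =
      ∫ _ in r ⁻¹' {x}, G x ∂(latticeMeasure Λ) := by
    refine setIntegral_congr_fun (hr (measurableSet_singleton x)) fun z hz => ?_
    have hz : r z = x := hz
    simp only [hz]
  rw [h1, setIntegral_const, measureReal_def, hr1 x]
  simp

theorem integrable_exp_neg_mul_norm (μ : Measure V) [μ.IsAddHaarMeasure] {δ : ℝ} (hδ : 0 < δ) :
    Integrable (fun z : V => Real.exp (-δ * ‖z‖)) μ := by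
  set k := Module.finrank ℝ V + 1 with hk
  have hint : Integrable (fun z : V => (1 + ‖z‖) ^ (-(k : ℝ))) μ :=
    integrable_one_add_norm (by rw [hk]; push_cast; linarith)
  refine (hint.const_mul (Real.exp δ * k.factorial / δ ^ k)).mono' ?_ ?_
  · exact (by fun_prop : Continuous fun z : V => Real.exp (-δ * ‖z‖)).aestronglyMeasurable
  · refine Filter.Eventually.of_forall fun z => ?_
    have hz : 0 < 1 + ‖z‖ := by positivity
    rw [Real.norm_of_nonneg (Real.exp_pos _).le, Real.rpow_neg hz.le, Real.rpow_natCast,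
      ← div_eq_mul_inv, div_div, le_div_iff₀ (by positivity)]
    have h1 := Real.pow_div_factorial_le_exp (δ * (1 + ‖z‖)) (by positivity) k
    rw [div_le_iff₀ (by positivity), mul_pow] at h1
    calc Real.exp (-δ * ‖z‖) * (δ ^ k * (1 + ‖z‖) ^ k)
        ≤ Real.exp (-δ * ‖z‖) * (Real.exp (δ * (1 + ‖z‖)) * k.factorial) := by gcongr
      _ = Real.exp δ * k.factorial := by
        rw [← mul_assoc, ← Real.exp_add]
        ring_nf

variable {Λ : Submodule ℤ V} [DiscreteTopology Λ] [IsZLattice ℝ Λ] {n : ℕ} {v : Fin n → V}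

theorem aestronglyMeasurable_rescaledStep {r : V → Λ} (hr : Measurable r) (p : Set V)
    (ξ : CDual V) (τ : ℝ) :
    AEStronglyMeasurable (rescaledStep r p ξ τ) (latticeMeasure Λ) := by
  have h1 : Measurable fun x : Λ => p.indicator (fun x => Complex.exp (τ * ξ x)) (x : V) :=
    measurable_of_countable _
  exact (h1.comp (hr.comp (measurable_const_smul τ⁻¹))).aestronglyMeasurable

theorem integrable_rescaledStep {r : V → Λ} (hr : Measurable r) {R : ℝ}
    (hR : ∀ z, ‖z - (r z : V)‖ ≤ R) {ξ : CDual V} (hξ : ξ ∈ convDomain v) (s : V) {τ : ℝ}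
    (hτ : 0 < τ) (hτ1 : τ ≤ 1) :
    Integrable (rescaledStep r
      (s +ᵥ ((PointedCone.hull ℝ (Set.range v) : PointedCone ℝ V) : Set V)) ξ τ)
      (latticeMeasure Λ) := by
  obtain ⟨K, δ, hδ, hb⟩ := exists_bound_rescaledStep hR hξ s
  exact ((integrable_exp_neg_mul_norm _ hδ).const_mul (Real.exp K)).mono'
    (aestronglyMeasurable_rescaledStep hr _ ξ τ) (Filter.Eventually.of_forall (hb τ hτ hτ1))

/-- The exponential sum over the lattice points of a shifted cone converges on the domain of
convergence, and is an integral. -/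
theorem hasSum_cone {r : V → Λ} (hr : Measurable r) {R : ℝ}
    (hR : ∀ z, ‖z - (r z : V)‖ ≤ R) (hr1 : ∀ x : Λ, latticeMeasure Λ (r ⁻¹' {x}) = 1)
    {ξ : CDual V} (hξ : ξ ∈ convDomain v) (s : V) :
    HasSum (fun x => latticeIndicator Λ
        (s +ᵥ ((PointedCone.hull ℝ (Set.range v) : PointedCone ℝ V) : Set V)) x *
          Complex.exp (ξ x))
      (∫ z, rescaledStep r
        (s +ᵥ ((PointedCone.hull ℝ (Set.range v) : PointedCone ℝ V) : Set V)) ξ 1 z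
          ∂(latticeMeasure Λ)) := by
  classical
  set p : Set V := s +ᵥ ((PointedCone.hull ℝ (Set.range v) : PointedCone ℝ V) : Set V) with hp
  have hG : (fun z => p.indicator (fun x => Complex.exp (ξ x)) ((r z : Λ) : V)) =
      rescaledStep r p ξ 1 := by
    funext z
    simp [rescaledStep]
  have hint := integrable_rescaledStep hr hR hξ s one_pos le_rfl
  rw [← hp, ← hG] at hint
  have h := hasSum_lattice_of_integrable hr hr1 hint
  rw [hG] at h
  have h2 := (hasSum_subtype_iff_indicator (s := (Λ : Set V))
    (f := p.indicator fun x => Complex.exp (ξ x))).mp h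
  refine h2.congr_fun fun x => ?_
  rw [latticeIndicator, Set.indicator_apply, Set.indicator_apply, Set.indicator_apply]
  by_cases h1 : x ∈ p <;> by_cases h2 : x ∈ Λ <;> simp [h1, h2]

theorem integral_rescaledStep {r : V → Λ} (p : Set V) (ξ : CDual V) {τ : ℝ} (hτ : 0 < τ) :
    ∫ z, rescaledStep r p ξ τ z ∂(latticeMeasure Λ) = (τ : ℂ) ^ Module.finrank ℝ V *
      ∫ z, rescaledStep r p ((τ : ℂ) • ξ) 1 z ∂(latticeMeasure Λ) := by
  have h := Measure.integral_comp_inv_smul (latticeMeasure Λ)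
    (rescaledStep r p ((τ : ℂ) • ξ) 1) τ
  rw [abs_of_nonneg (pow_nonneg hτ.le _), Complex.real_smul, Complex.ofReal_pow] at h
  rw [← h]
  congr 1
  funext z
  simp [rescaledStep]

theorem integrableOn_exp_cone {ξ : CDual V} (hξ : ξ ∈ convDomain v) :
    IntegrableOn (fun x : V => Complex.exp (ξ x))
      ((PointedCone.hull ℝ (Set.range v) : PointedCone ℝ V) : Set V) (latticeMeasure Λ) := by
  obtain ⟨C, hC, hb⟩ := exists_norm_le_of_mem_convDomain hξ
  have hnull : NullMeasurableSet ((PointedCone.hull ℝ (Set.range v) : PointedCone ℝ V) : Set V)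
      (latticeMeasure Λ) := (PointedCone.convex _).nullMeasurableSet _
  refine Integrable.mono' (g := fun z : V => Real.exp (-C⁻¹ * ‖z‖))
    (integrable_exp_neg_mul_norm _ (inv_pos.mpr hC)).integrableOn ?_ ?_
  · exact (Complex.continuous_exp.comp ξ.continuous).aestronglyMeasurable
  · rw [ae_restrict_iff'₀ hnull]
    refine Filter.Eventually.of_forall fun z hz => ?_
    rw [Complex.norm_exp]
    refine Real.exp_le_exp.mpr ?_
    have : C⁻¹ * ‖z‖ ≤ -(ξ z).re := by
      rw [inv_mul_le_iff₀ hC]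
      exact hb z hz
    linarith

/-- Riemann sums: `τ^d ∑ e^{τ⟨ξ,x⟩}`, summed over the lattice points of `s + c`, tends to
`∫_c e^⟨ξ,x⟩ dx` as `τ → 0⁺`. -/
theorem tendsto_pow_mul_integral_rescaledStep {r : V → Λ} (hr : Measurable r) {R : ℝ}
    (hR : ∀ z, ‖z - (r z : V)‖ ≤ R) {ξ : CDual V} (hξ : ξ ∈ convDomain v) (s : V) :
    Tendsto (fun τ : ℝ => (τ : ℂ) ^ Module.finrank ℝ V *
      ∫ z, rescaledStep r (s +ᵥ ((PointedCone.hull ℝ (Set.range v) : PointedCone ℝ V) : Set V))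
        ((τ : ℂ) • ξ) 1 z ∂(latticeMeasure Λ)) (𝓝[>] 0)
      (𝓝 (∫ x in ((PointedCone.hull ℝ (Set.range v) : PointedCone ℝ V) : Set V),
        Complex.exp (ξ x) ∂(latticeMeasure Λ))) := by
  have hconv : Convex ℝ ((PointedCone.hull ℝ (Set.range v) : PointedCone ℝ V) : Set V) :=
    PointedCone.convex _
  obtain ⟨K, δ, hδ, hb⟩ := exists_bound_rescaledStep hR hξ s
  rw [← integral_indicator₀ (hconv.nullMeasurableSet _)]
  have hev : ∀ᶠ τ : ℝ in 𝓝[>] 0, 0 < τ ∧ τ ≤ 1 := by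
    filter_upwards [self_mem_nhdsWithin,
      mem_nhdsWithin_of_mem_nhds (Iic_mem_nhds (zero_lt_one' ℝ))] with τ h1 h2 using ⟨h1, h2⟩
  refine Tendsto.congr' ?_ (tendsto_integral_filter_of_dominated_convergence
    (F := fun τ => rescaledStep r
      (s +ᵥ ((PointedCone.hull ℝ (Set.range v) : PointedCone ℝ V) : Set V)) ξ τ)
    (fun z => Real.exp K * Real.exp (-δ * ‖z‖))
    (Filter.Eventually.of_forall fun τ => aestronglyMeasurable_rescaledStep hr _ ξ τ) ?_
    ((integrable_exp_neg_mul_norm _ hδ).const_mul _) ?_)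
  · filter_upwards [hev] with τ hτ
    exact integral_rescaledStep _ ξ hτ.1
  · filter_upwards [hev] with τ hτ
    exact Filter.Eventually.of_forall (hb τ hτ.1 hτ.2)
  · have hfr := hconv.addHaar_frontier (latticeMeasure Λ)
    filter_upwards [compl_mem_ae_iff.mpr hfr] with z hz
    exact tendsto_rescaledStep hR _ ξ s hz

end Riemann

/-! ### The generating functions of shifted rational cones -/

section ConeGen

variable {V : Type*} [NormedAddCommGroup V] [NormedSpace ℝ V] [FiniteDimensional ℝ V]

theorem interior_nonempty_of_isFullDim {c : PointedCone ℝ V} (hfull : IsFullDim c) :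
    (interior (c : Set V)).Nonempty := by
  have h0 : (0 : V) ∈ (c : Set V) := c.zero_mem
  rw [c.convex.interior_nonempty_iff_affineSpan_eq_top,
    AffineSubspace.affineSpan_eq_top_iff_vectorSpan_eq_top_of_nonempty ℝ V V ⟨0, h0⟩,
    vectorSpan_eq_span_vsub_set_right ℝ h0]
  have h : Submodule.span ℝ (c : Set V) = ⊤ := hfull
  simpa using h

/-- Near `0` and off finitely many hyperplanes there are real forms in the domain of convergence. -/
theorem exists_realForm_of_eventually {n : ℕ} {v : Fin n → V} {l₀ : V →L[ℝ] ℝ}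
    (hl₀ : realForm l₀ ∈ convDomain v) {p : CDual V → Prop} (hp : ∀ᶠ ξ in nearZero V, p ξ) :
    ∃ l : V →L[ℝ] ℝ, realForm l ∈ convDomain v ∧ p (realForm l) := by
  obtain ⟨W, hW, hp⟩ := eventually_nearZero_iff.mp hp
  obtain ⟨l₁, hl₁⟩ := Module.exists_dual_forall_apply_ne_zero (K := ℝ) (fun w : W => (w : V))
    fun w => hW w w.2
  -- a small generic perturbation of `l₀` avoids the hyperplanes
  set L₁ : V →L[ℝ] ℝ := LinearMap.toContinuousLinearMap l₁
  have hcont : Continuous fun δ : ℝ => realForm (l₀ + δ • L₁) := by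
    have h : ∀ δ : ℝ, realForm (l₀ + δ • L₁) = realForm l₀ + δ • realForm L₁ := fun δ => by
      ext x
      simp
    simp only [h]
    fun_prop
  have e1 : ∀ᶠ δ in 𝓝[≠] (0 : ℝ), realForm (l₀ + δ • L₁) ∈ convDomain v := by
    refine (hcont.tendsto 0).mono_left nhdsWithin_le_nhds |>.eventually
      ((isOpen_convDomain v).mem_nhds ?_)
    simpa using hl₀
  have e2 : ∀ᶠ δ in 𝓝[≠] (0 : ℝ), ∀ w ∈ W, (l₀ + δ • L₁) w ≠ 0 := by
    refine (Filter.eventually_all_finset W).mpr fun w hw => ?_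
    have hw1 : L₁ w ≠ 0 := hl₁ ⟨w, hw⟩
    have : ∀ᶠ δ in 𝓝[≠] (0 : ℝ), δ ≠ -(l₀ w) / L₁ w := by
      rcases eq_or_ne (-(l₀ w) / L₁ w) 0 with h | h
      · rw [h]
        exact self_mem_nhdsWithin
      · exact (isOpen_ne.mem_nhds h.symm : {δ : ℝ | δ ≠ -(l₀ w) / L₁ w} ∈ 𝓝 0) |>
          mem_nhdsWithin_of_mem_nhds
    filter_upwards [this] with δ hδ h
    rw [_root_.add_apply, _root_.smul_apply, smul_eq_mul] at h
    exact hδ (by rw [eq_div_iff hw1]; linarith)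
  obtain ⟨δ, hδ1, hδ2⟩ := (e1.and e2).exists
  set l := l₀ + δ • L₁
  have e3 : ∀ᶠ t : ℝ in 𝓝[>] 0, (∀ w ∈ W, ((t : ℂ) • realForm l) w ≠ 0) →
      p ((t : ℂ) • realForm l) := by
    have hc : Continuous fun t : ℝ => (t : ℂ) • realForm l :=
      Complex.continuous_ofReal.smul continuous_const
    have h0 := (hc.tendsto 0).mono_left (nhdsWithin_le_nhds (s := Set.Ioi (0 : ℝ)))
    rw [Complex.ofReal_zero, zero_smul ℂ (realForm l)] at h0
    exact h0.eventually hp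
  obtain ⟨t, ht, ht0⟩ := (e3.and self_mem_nhdsWithin).exists
  have ht0 : 0 < t := ht0
  have hsm : realForm (t • l) = (t : ℂ) • realForm l := by
    ext x
    simp
  refine ⟨t • l, ?_, ?_⟩
  · rw [hsm]
    exact smul_mem_convDomain hδ1 ht0
  · rw [hsm]
    refine ht fun w hw => ?_
    rw [_root_.smul_apply, smul_eq_mul, realForm_apply]
    exact mul_ne_zero (by exact_mod_cast ht0.ne') (by exact_mod_cast hδ2 w hw)

variable [MeasurableSpace V] [BorelSpace V]

/-- If `e^⟨ξ,x⟩` is integrable over a full-dimensional cone without lines, then `ξ` belongs to the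
domain of convergence. Otherwise translation by a generator `v i` would not decrease the integral
over the cone, although the cone minus its translate has positive measure. -/
theorem mem_convDomain_of_integrableOn (μ : Measure V) [μ.IsAddHaarMeasure] {n : ℕ}
    {v : Fin n → V} {ξ₀ : CDual V} (hξ₀ : ξ₀ ∈ convDomain v)
    (hfull : IsFullDim (PointedCone.hull ℝ (Set.range v))) {ξ : CDual V}
    (hint : IntegrableOn (fun x : V => Complex.exp (ξ x))
      ((PointedCone.hull ℝ (Set.range v) : PointedCone ℝ V) : Set V) μ) : ξ ∈ convDomain v := by
  classical
  intro i
  by_contra! hneg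
  set c : PointedCone ℝ V := PointedCone.hull ℝ (Set.range v) with hc
  have hvc : v i ∈ c := PointedCone.subset_hull (Set.mem_range_self i)
  obtain ⟨y, hy⟩ := interior_nonempty_of_isFullDim hfull
  -- an open subset of the cone which is disjoint from its translate by `v i`
  obtain ⟨ε, hε, hεy⟩ : ∃ ε : ℝ, 0 < ε ∧ (ξ₀ (v i)).re < (ξ₀ (ε • y)).re := by
    have hcont : Continuous fun t : ℝ => (ξ₀ (t • y)).re := by fun_prop
    have h0 : (ξ₀ (v i)).re < (ξ₀ ((0 : ℝ) • y)).re := by simpa using hξ₀ i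
    have h1 : ∀ᶠ t in 𝓝[>] (0 : ℝ), (ξ₀ (v i)).re < (ξ₀ (t • y)).re :=
      ((hcont.tendsto 0).eventually (lt_mem_nhds h0)).filter_mono nhdsWithin_le_nhds
    obtain ⟨t, h1, h2⟩ := (h1.and self_mem_nhdsWithin).exists
    exact ⟨t, h2, h1⟩
  set U : Set V := (ε • interior (c : Set V)) ∩ {x | (ξ₀ (v i)).re < (ξ₀ x).re} with hU
  have hUo : IsOpen U := (isOpen_interior.smul₀ hε.ne').inter
    (isOpen_lt continuous_const (Complex.continuous_re.comp ξ₀.continuous))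
  have hUne : U.Nonempty := ⟨ε • y, Set.smul_mem_smul_set hy, hεy⟩
  have hUc : ∀ x ∈ U, x ∈ c := by
    rintro _ ⟨⟨x, hx, rfl⟩, -⟩
    exact c.smul_mem hε.le (interior_subset hx)
  have hUd : ∀ x ∈ U, x - v i ∉ c := by
    rintro x ⟨-, hx⟩ hmem
    have hx : (ξ₀ (v i)).re < (ξ₀ x).re := hx
    obtain ⟨C, hC, hb⟩ := exists_norm_le_of_mem_convDomain hξ₀
    have h1 := (norm_nonneg _).trans (hb _ hmem)
    rw [map_sub, Complex.sub_re] at h1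
    nlinarith
  set h : V → ENNReal := fun x => ENNReal.ofReal (Real.exp (ξ x).re) with hh
  have hhm : Measurable h := ENNReal.measurable_ofReal.comp
    (Real.measurable_exp.comp (Complex.measurable_re.comp ξ.continuous.measurable))
  set H : V → ENNReal := (c : Set V).indicator h with hH
  have hnull : NullMeasurableSet (c : Set V) μ := c.convex.nullMeasurableSet _
  have hfin : ∫⁻ x, H x ∂μ ≠ ⊤ := by
    rw [hH, lintegral_indicator₀ hnull]
    have := hint.2.ne
    refine ne_of_eq_of_ne (lintegral_congr fun x => ?_) this
    rw [hh]
    simp only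
    rw [← Complex.norm_exp, ofReal_norm]
  have hle : ∀ x, H (x + -v i) + U.indicator h x ≤ H x := by
    intro x
    rw [← sub_eq_add_neg]
    by_cases h1 : x - v i ∈ c
    · have h2 : x ∉ U := fun hx => hUd x hx h1
      have h3 : x ∈ c := by
        have := c.add_mem h1 hvc
        rwa [sub_add_cancel] at this
      rw [hH, Set.indicator_of_mem (show x - v i ∈ (c : Set V) from h1),
        Set.indicator_of_mem (show x ∈ (c : Set V) from h3), Set.indicator_of_notMem h2, add_zero]
      refine ENNReal.ofReal_le_ofReal (Real.exp_le_exp.mpr ?_)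
      rw [map_sub, Complex.sub_re]
      linarith
    · rw [hH, Set.indicator_of_notMem (show x - v i ∉ (c : Set V) from h1), zero_add]
      exact Set.indicator_le_indicator_of_subset (fun x hx => hUc x hx) (fun _ => zero_le) x
  have hpos : 0 < ∫⁻ x, U.indicator h x ∂μ := by
    rw [lintegral_indicator hUo.measurableSet, setLIntegral_pos_iff hhm]
    have : Function.support h = Set.univ := by
      ext x
      simp [hh, Real.exp_pos]
    rw [this, Set.univ_inter]
    exact hUo.measure_pos μ hUne
  have h1 : ∫⁻ x, H x ∂μ + ∫⁻ x, U.indicator h x ∂μ ≤ ∫⁻ x, H x ∂μ := by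
    conv_lhs => rw [← lintegral_add_right_eq_self H (-v i)]
    rw [← lintegral_add_right _ (hhm.indicator hUo.measurableSet)]
    exact lintegral_mono hle
  exact absurd h1 (not_le.mpr (ENNReal.lt_add_right hfin hpos.ne'))

variable (Λ : Submodule ℤ V) [DiscreteTopology Λ] [IsZLattice ℝ Λ]

/-- `S(s + c)` is the generating function of the lattice points of `s + c`. -/
theorem hasGen_genS {c : PointedCone ℝ V} (hc : IsRationalCone Λ c) (s : V) :
    HasGen (latticeIndicator Λ (s +ᵥ (c : Set V))) (genS Λ (s +ᵥ (c : Set V))) := by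
  obtain ⟨F, hF⟩ := exists_hasGen_cone Λ hc s
  obtain ⟨n, v, hv0, hvΛ, rfl⟩ := hc.exists_generators
  rcases neg_mem_hull_or_exists_form v with ⟨i, hi⟩ | ⟨l, hl⟩
  · rw [genS, if_pos (containsLine_vadd (hv0 i) hi s)]
    exact hasGen_zero_of_neg_mem (hv0 i) (hvΛ i) hi s
  · rw [genS, if_neg (not_containsLine hl s)]
    obtain ⟨r, R, -, hr, hR, hr1⟩ := exists_lattice_floor Λ
    rw [continuation_eq (F := F) ⟨hF.mem_meroLin, ?_⟩ (isOpen_convDomain v) ⟨_, hl⟩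
      (fun ξ hξ t ht => smul_mem_convDomain hξ ht) ?_]
    · exact hF
    · induction F using Filter.Germ.inductionOn with | _ f
      refine ⟨f, rfl, ?_⟩
      filter_upwards [hF.eventually_eq_of_hasSum] with ξ hξ z hz
      exact hξ z (hasSum_latticeIndicator_iff.mpr hz)
    · exact fun ξ hξ => ⟨_, hasSum_latticeIndicator_iff.mp (hasSum_cone hr hR hr1 hξ s)⟩

/-- On the domain of convergence, the expansion of `S(s + c)` along lines starts in degree at least
`-d`, and its coefficient in degree `-d` is the integral over `c`. -/
theorem eventually_lowest {n : ℕ} {v : Fin n → V} (hvΛ : ∀ i, v i ∈ Λ) (s : V)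
    {a : ℤ → CDual V → ℂ} (ha : HasExpansion (genS Λ
      (s +ᵥ ((PointedCone.hull ℝ (Set.range v) : PointedCone ℝ V) : Set V))) a) :
    ∀ᶠ ξ in nearZero V, ξ ∈ convDomain v →
      (∀ m < -(Module.finrank ℝ V : ℤ), a m ξ = 0) ∧ a (-(Module.finrank ℝ V : ℤ)) ξ =
        ∫ x in ((PointedCone.hull ℝ (Set.range v) : PointedCone ℝ V) : Set V),
          Complex.exp (ξ x) ∂(latticeMeasure Λ) := by
  classical
  have hc : IsRationalCone Λ (PointedCone.hull ℝ (Set.range v)) :=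
    ⟨Finset.univ.image v, by simpa using hvΛ, by simp⟩
  obtain ⟨r, R, -, hr, hR, hr1⟩ := exists_lattice_floor Λ
  have hF := hasGen_genS Λ hc s
  generalize genS Λ
    (s +ᵥ ((PointedCone.hull ℝ (Set.range v) : PointedCone ℝ V) : Set V)) = F at hF ha
  induction F using Filter.Germ.inductionOn with | _ f
  filter_upwards [ha.hasLaurent rfl, eventually_ray hF.eventually_eq_of_hasSum] with ξ h1 h2 hξ
  refine h1.lowest_of_tendsto
    ((tendsto_pow_mul_integral_rescaledStep hr hR hξ s).congr' ?_)
  filter_upwards [tendsto_ofReal_nhdsGT_zero.eventually h2, self_mem_nhdsWithin] with t h3 h4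
  rw [h3 _ (hasSum_cone hr hR hr1 (smul_mem_convDomain hξ h4) s)]

/-- The components of `S(s + c)` of degree less than `-d` vanish, and the component of degree `-d`
is `I(c)`. -/
theorem exists_hasExpansion_genS {c : PointedCone ℝ V} (hc : IsRationalCone Λ c)
    (hfull : IsFullDim c) (s : V) :
    ∃ a : ℤ → CDual V → ℂ, HasExpansion (genS Λ (s +ᵥ (c : Set V))) a ∧
      (∀ᶠ ξ in nearZero V, ∀ m < -(Module.finrank ℝ V : ℤ), a m ξ = 0) ∧
      (a (-(Module.finrank ℝ V : ℤ)) : FGerm V) = genI Λ (c : Set V) := by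
  obtain ⟨a, N, ha, haN, ham⟩ := exists_hasExpansion (hasGen_genS Λ hc s).mem_meroLin
  obtain ⟨n, v, hv0, hvΛ, rfl⟩ := hc.exists_generators
  rcases neg_mem_hull_or_exists_form v with ⟨i, hi⟩ | ⟨l, hl⟩
  · have hline := containsLine_vadd (hv0 i) hi
    refine ⟨0, ?_, Filter.Eventually.of_forall fun ξ m _ => rfl, ?_⟩
    · rw [genS, if_pos (hline s)]
      exact HasExpansion.zero
    · have := hline 0
      rw [zero_vadd] at this
      rw [genI, if_pos this]
      rfl
  · have hlow := eventually_lowest Λ hvΛ s ha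
    refine ⟨a, ha, ?_, ?_⟩
    · have hm0 : ∀ m < -(Module.finrank ℝ V : ℤ), ∀ᶠ ξ in nearZero V, a m ξ = 0 := fun m hm => by
        refine Filter.Germ.coe_eq.mp (eq_of_eventually_eqOn_cone (ham m) zero_mem_meroLin rfl
          (f' := 0) rfl (isOpen_convDomain v) ⟨_, hl⟩
          (fun ξ hξ t ht => smul_mem_convDomain hξ ht) ?_)
        filter_upwards [hlow] with ξ h1 h2 using (h1 h2).1 m hm
      -- only finitely many degrees are involved, as `a` vanishes in all degrees below `-N`
      have hfin := (Filter.eventually_all_finset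
        (Finset.Ico (-(N : ℤ)) (-(Module.finrank ℝ V : ℤ)))).mpr fun m hm =>
          hm0 m (Finset.mem_Ico.mp hm).2
      filter_upwards [hfin] with ξ hξ m hm
      by_cases hmN : m < -(N : ℤ)
      · rw [haN m hmN, Pi.zero_apply]
      · exact hξ m (Finset.mem_Ico.mpr ⟨not_lt.mp hmN, hm⟩)
    · have := not_containsLine hl 0
      rw [zero_vadd] at this
      rw [genI, if_neg this]
      refine (continuation_eq ⟨ham _, _, rfl, ?_⟩ (isOpen_convDomain v) ⟨_, hl⟩
        (fun ξ hξ t ht => smul_mem_convDomain hξ ht) ?_).symm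
      · filter_upwards [hlow] with ξ h1 z hz
        rw [hz.2]
        exact (h1 (mem_convDomain_of_integrableOn _ hl hfull hz.1)).2
      · exact fun ξ hξ => ⟨_, integrableOn_exp_cone hξ, rfl⟩

/-- `I(c) ≠ 0`, because at real forms its values are integrals of positive functions. -/
theorem genI_ne_zero {c : PointedCone ℝ V} (hc : IsRationalCone Λ c) (hfull : IsFullDim c)
    (hline : ¬ ContainsLine (c : Set V)) : genI Λ (c : Set V) ≠ 0 := by
  intro hzero
  obtain ⟨a, ha, -, hI⟩ := exists_hasExpansion_genS Λ hc hfull 0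
  obtain ⟨n, v, hv0, hvΛ, rfl⟩ := hc.exists_generators
  rcases neg_mem_hull_or_exists_form v with ⟨i, hi⟩ | ⟨l₀, hl₀⟩
  · have := containsLine_vadd (hv0 i) hi 0
    rw [zero_vadd] at this
    exact hline this
  rw [hzero] at hI
  have h0 : ∀ᶠ ξ in nearZero V, a (-(Module.finrank ℝ V : ℤ)) ξ = 0 := Filter.Germ.coe_eq.mp hI
  obtain ⟨l, hl, h1, h2⟩ := exists_realForm_of_eventually hl₀
    (h0.and (eventually_lowest Λ hvΛ 0 ha))
  rw [(h2 hl).2] at h1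
  simp only [realForm_apply, ← Complex.ofReal_exp] at h1
  rw [integral_complex_ofReal, Complex.ofReal_eq_zero] at h1
  have hint : IntegrableOn (fun x : V => Real.exp (l x))
      ((PointedCone.hull ℝ (Set.range v) : PointedCone ℝ V) : Set V) (latticeMeasure Λ) := by
    have := (integrableOn_exp_cone (Λ := Λ) hl).re
    refine this.congr (Filter.Eventually.of_forall fun x => ?_)
    simp only [realForm_apply, ← Complex.ofReal_exp]
    rfl
  have hne : NeZero ((latticeMeasure Λ).restrict
      ((PointedCone.hull ℝ (Set.range v) : PointedCone ℝ V) : Set V)) := by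
    refine ⟨fun h => ?_⟩
    rw [Measure.restrict_eq_zero] at h
    have hpos := isOpen_interior.measure_pos (latticeMeasure Λ)
      (interior_nonempty_of_isFullDim hfull)
    exact hpos.ne' (measure_mono_null interior_subset h)
  exact (integral_exp_pos hint).ne' h1

end ConeGen

/-! ### Unimodular cones -/

section Unimodular

variable {V : Type*} [NormedAddCommGroup V] [NormedSpace ℝ V]

theorem germ_mul_smul (F G : FGerm V) (r : ℝ) : F * (r • G) = r • (F * G) := by
  induction F using Filter.Germ.inductionOn with | _ f
  induction G using Filter.Germ.inductionOn with | _ g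
  exact congrArg _ (mul_smul_comm r f g)

theorem germ_smul_mul (F G : FGerm V) (r : ℝ) : (r • F) * G = r • (F * G) := by
  rw [mul_comm, germ_mul_smul, mul_comm]

/-- The lattice points whose coordinates in a basis `b` are equal to `k j` for `j ∉ J` and at least
`k j` for `j ∈ J`. -/
def orthant {ι : Type*} [Fintype ι] [DecidableEq ι] (b : ι → V) (k : ι → ℤ) (J : Finset ι) :
    Set V :=
  {x | ∃ m : ι → ℤ, (∀ j ∈ J, k j ≤ m j) ∧ (∀ j ∉ J, m j = k j) ∧ x = ∑ j, m j • b j}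

/-- The lattice points of an orthant have the generating function
`e^⟨ξ,x⟩ / ∏_{j ∈ J} (1 - e^⟨ξ,b_j⟩)` with `x = ∑ k_j b_j`. -/
theorem hasGen_orthant {ι : Type*} [Fintype ι] [DecidableEq ι] {b : ι → V}
    (hb : LinearIndependent ℤ b) (k : ι → ℤ) (J : Finset ι) :
    ∃ F, HasGen ((orthant b k J).indicator 1) F ∧ (∏ j ∈ J, oneSubExp (b j)) * F =
      ((fun ξ => Complex.exp (ξ (∑ j, k j • b j)) : CDual V → ℂ) : FGerm V) := by
  have hb0 : ∀ j, b j ≠ 0 := hb.ne_zero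
  have hinj : ∀ m m' : ι → ℤ, ∑ j, m j • b j = ∑ j, m' j • b j → m = m' := by
    intro m m' h
    funext j
    refine sub_eq_zero.mp (Fintype.linearIndependent_iff.mp hb (fun j => m j - m' j) ?_ j)
    simp only [sub_smul, Finset.sum_sub_distrib, h, sub_self]
  induction J using Finset.induction_on with
  | empty =>
    have hset : orthant b k ∅ = {∑ j, k j • b j} := by
      ext x
      constructor
      · rintro ⟨m, -, hm, rfl⟩
        rw [Set.mem_singleton_iff, show m = k from funext fun j => hm j (Finset.notMem_empty j)]
      · rintro rfl
        exact ⟨k, by simp, by simp, rfl⟩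
    have hfin : (Function.support ((orthant b k ∅).indicator 1 : V → ℂ)).Finite := by
      rw [hset]
      exact (Set.finite_singleton _).subset Set.support_indicator_subset
    refine ⟨_, HasGen.of_finite hfin, ?_⟩
    rw [Finset.prod_empty, one_mul]
    congr 1
    funext ξ
    rw [expSum, hset, tsum_eq_single (∑ j, k j • b j)]
    · simp
    · intro x hx
      simp [hx]
  | insert i J hi ih =>
    obtain ⟨G, hG, hGe⟩ := ih
    have hdiff : diffOp (b i) ((orthant b k (insert i J)).indicator 1) =
        ((orthant b k J).indicator 1 : V → ℂ) := by
      have hupd : ∀ (m : ι → ℤ) (a : ℤ), ∑ j, Function.update m i (m i + a) j • b j =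
          ∑ j, m j • b j + a • b i := by
        intro m a
        rw [← Finset.add_sum_erase _ _ (Finset.mem_univ i),
          ← Finset.add_sum_erase _ (fun j => m j • b j) (Finset.mem_univ i),
          Function.update_self, add_smul, Finset.sum_congr rfl fun j hj => by
            rw [Function.update_of_ne (Finset.ne_of_mem_erase hj)]]
        abel
      refine diffOp_indicator (fun x => ?_) ?_
      · constructor
        · rintro ⟨m, h1, h2, rfl⟩
          rcases (h1 i (Finset.mem_insert_self i J)).eq_or_lt with heq | hlt
          · refine Or.inl ⟨m, fun j hj => h1 j (Finset.mem_insert_of_mem hj), fun j hj => ?_, rfl⟩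
            rcases eq_or_ne j i with rfl | hne
            · exact heq.symm
            · exact h2 j (by simp [hne, hj])
          · refine Or.inr ⟨Function.update m i (m i + -1), fun j hj => ?_, fun j hj => ?_, ?_⟩
            · rcases eq_or_ne j i with rfl | hne
              · rw [Function.update_self]
                omega
              · rw [Function.update_of_ne hne]
                exact h1 j hj
            · rw [Function.update_of_ne (fun h => hj (by simp [h]))]
              exact h2 j hj
            · rw [hupd, neg_one_smul, sub_eq_add_neg]
        · rintro (⟨m, h1, h2, rfl⟩ | ⟨m, h1, h2, hx⟩)
          · refine ⟨m, fun j hj => ?_, fun j hj => h2 j fun h => hj (by simp [h]), rfl⟩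
            rcases eq_or_ne j i with rfl | hne
            · exact (h2 j hi).ge
            · exact h1 j ((Finset.mem_insert.mp hj).resolve_left hne)
          · refine ⟨Function.update m i (m i + 1), fun j hj => ?_, fun j hj => ?_, ?_⟩
            · rcases eq_or_ne j i with rfl | hne
              · rw [Function.update_self]
                have := h1 j hj
                omega
              · rw [Function.update_of_ne hne]
                exact h1 j hj
            · rw [Function.update_of_ne (fun h => hj (by simp [h]))]
              exact h2 j hj
            · rw [hupd, one_smul, ← hx, sub_add_cancel]
      · rintro _ ⟨m, h1, h2, rfl⟩ ⟨m', h1', h2', hx⟩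
        have h3 : m = Function.update m' i (m' i + 1) := hinj _ _ (by
          rw [hupd, one_smul, ← hx, sub_add_cancel])
        have h4 := congrFun h3 i
        rw [Function.update_self, h2 i hi] at h4
        have := h1' i (Finset.mem_insert_self i J)
        omega
    obtain ⟨E, hE⟩ := exists_oneSubExp_mul_eq_one (hb0 i)
    refine ⟨E * G, HasGen.of_diffOp (hb0 i) (by rwa [hdiff]) (by rw [← mul_assoc, hE, one_mul]), ?_⟩
    rw [Finset.prod_insert hi, ← hGe]
    linear_combination (∏ j ∈ J, oneSubExp (b j)) * G * hE

theorem isRationalCone_unimodularCone {Λ : Submodule ℤ V} {N : ℕ} (b : Module.Basis (Fin N) ℤ Λ) :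
    IsRationalCone Λ (unimodularCone b) := by
  classical
  exact ⟨Finset.univ.image fun j => (b j : V), by simp, by simp [unimodularCone]⟩

variable [FiniteDimensional ℝ V]

/-- The germ `T` of `∏ 1 / (1 - e^⟨ξ,w_j⟩)`, with an expansion whose components of degree less than
`-N` vanish. -/
theorem exists_todd_germ {N : ℕ} (w : Fin N → V) (hw : ∀ j, w j ≠ 0) :
    ∃ (T : FGerm V) (a : ℤ → CDual V → ℂ), (∏ j, oneSubExp (w j)) * T = 1 ∧ HasExpansion T a ∧
      (∀ n < -(N : ℤ), a n = 0) ∧ ∀ n, -(N : ℤ) ≤ n → (a n : FGerm V) ∈ HomRat V n := by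
  obtain ⟨t, ht, hte⟩ := exists_analyticAt_mul_one_sub_exp
  have hφ : AnalyticAt ℂ (fun ξ : CDual V => ∏ j, t (ξ (w j))) 0 :=
    Finset.analyticAt_fun_prod _ fun j _ => by
      have : AnalyticAt ℂ t ((fun ξ : CDual V => ξ (w j)) 0) := by simpa using ht
      exact this.fun_comp (f := fun ξ : CDual V => ξ (w j)) (analyticAt_dual_apply (w j) 0)
  obtain ⟨a, h1, h2, h3⟩ := hasExpansion_div w hw hφ
  refine ⟨_, a, ?_, h1, h2, h3⟩
  have hprod : ∏ j, oneSubExp (w j) =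
      ((fun ξ => ∏ j, (1 - Complex.exp (ξ (w j))) : CDual V → ℂ) : FGerm V) := by
    have := map_prod (Filter.Germ.coeRingHom (R := ℂ) (nearZero V))
      (fun j => (fun ξ => 1 - Complex.exp (ξ (w j)) : CDual V → ℂ)) Finset.univ
    refine this.symm.trans (congrArg _ (funext fun ξ => ?_))
    rw [Finset.prod_apply]
  rw [hprod]
  refine Filter.Germ.coe_eq.mpr ?_
  have e1 : ∀ᶠ ξ in nearZero V, ∀ j, t (ξ (w j)) * (1 - Complex.exp (ξ (w j))) = ξ (w j) := by
    refine Filter.eventually_all.mpr fun j => Filter.Eventually.filter_mono inf_le_left ?_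
    have : Tendsto (fun ξ : CDual V => ξ (w j)) (𝓝 0) (𝓝 0) := by
      simpa using (continuous_dual_apply (w j)).tendsto 0
    exact this.eventually hte
  filter_upwards [e1, Filter.eventually_all.mpr fun j => eventually_apply_ne_zero (hw j)]
    with ξ h1 h2
  rw [mul_div_assoc', div_eq_one_iff_eq (Finset.prod_ne_zero_iff.mpr fun j _ => h2 j), mul_comm,
    ← Finset.prod_mul_distrib]
  exact Finset.prod_congr rfl fun j _ => h1 j

variable {Λ : Submodule ℤ V} [DiscreteTopology Λ]
  [IsZLattice ℝ Λ]

/-- `x ∈ Λ` lies in `s + u` if and only if its coordinates are at least those of `s`, rounded up. -/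
theorem lattice_points_unimodularCone {N : ℕ} (b : Module.Basis (Fin N) ℤ Λ) (s : V) :
    {x | x ∈ s +ᵥ (unimodularCone b : Set V) ∧ x ∈ Λ} =
      orthant (fun j => (b j : V)) (fun j => ⌈(b.ofZLatticeBasis ℝ Λ).repr s j⌉) Finset.univ := by
  set B := b.ofZLatticeBasis ℝ Λ with hB
  have hBb : ∀ j, B j = (b j : V) := fun j => b.ofZLatticeBasis_apply ℝ Λ j
  have hcone : ∀ y, y ∈ unimodularCone b ↔ ∀ j, 0 ≤ B.repr y j := by
    intro y
    rw [unimodularCone, mem_hull_range_iff]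
    constructor
    · rintro ⟨t, ht, rfl⟩ j
      simp only [← hBb]
      rw [B.repr_sum_self]
      exact ht j
    · intro h
      refine ⟨fun j => B.repr y j, h, ?_⟩
      simp only [← hBb]
      exact (B.sum_repr y).symm
  ext x
  simp only [Set.mem_ofPred_eq, mem_vadd_iff_sub_mem]
  rw [hcone]
  constructor
  · rintro ⟨h1, h2⟩
    refine ⟨fun j => b.repr ⟨x, h2⟩ j, fun j _ => ?_, fun j hj => absurd (Finset.mem_univ j) hj, ?_⟩
    · have h3 := h1 j
      rw [map_sub, Finsupp.sub_apply, sub_nonneg] at h3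
      have h4 : B.repr x j = (b.repr ⟨x, h2⟩ j : ℝ) :=
        b.ofZLatticeBasis_repr_apply ℝ Λ ⟨x, h2⟩ j
      rw [h4] at h3
      exact Int.ceil_le.mpr h3
    · have := congrArg Λ.subtype (b.sum_repr ⟨x, h2⟩)
      rw [map_sum] at this
      exact this.symm
  · rintro ⟨m, h1, -, rfl⟩
    refine ⟨fun j => ?_, Λ.sum_mem fun j _ => Λ.smul_mem _ (b j).2⟩
    have h3 : ∑ j, m j • (b j : V) = ∑ j, (m j : ℝ) • B j := by
      refine Finset.sum_congr rfl fun j _ => ?_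
      rw [hBb, Int.cast_smul_eq_zsmul]
    rw [h3, map_sub, Finsupp.sub_apply, sub_nonneg, B.repr_sum_self]
    exact Int.ceil_le.mp (h1 j (Finset.mem_univ j))

variable [MeasurableSpace V] [BorelSpace V]

/-- For a unimodular cone `u` with generators `v_j`, `M(s,u)(ξ) = e^⟨ξ,y⟩ ∏ 1 / (1 - e^⟨ξ,v_j⟩)`,
where `y = ∑ {-⟨η_j,s⟩} v_j`. -/
theorem genM_unimodularCone {N : ℕ} (b : Module.Basis (Fin N) ℤ Λ) {T : FGerm V}
    (hT : (∏ j, oneSubExp (b j : V)) * T = 1) (s : V) :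
    genM Λ s (unimodularCone b) = ((fun ξ => Complex.exp (ξ (∑ j,
      Int.fract ((-(b.ofZLatticeBasis ℝ Λ).coord j) s) • b.ofZLatticeBasis ℝ Λ j)) :
        CDual V → ℂ) : FGerm V) * T := by
  set B := b.ofZLatticeBasis ℝ Λ with hB
  have hBb : ∀ j, B j = (b j : V) := fun j => b.ofZLatticeBasis_apply ℝ Λ j
  have hli : LinearIndependent ℤ fun j => (b j : V) :=
    b.linearIndependent.map' Λ.subtype (Submodule.ker_subtype Λ)
  obtain ⟨F, hF, hFe⟩ := hasGen_orthant hli (fun j => ⌈B.repr s j⌉) Finset.univ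
  have hS : genS Λ (s +ᵥ (unimodularCone b : Set V)) = F := by
    refine (hasGen_genS Λ (isRationalCone_unimodularCone b) s).unique ?_
    rwa [latticeIndicator, lattice_points_unimodularCone]
  have hF2 : F = ((fun ξ => Complex.exp (ξ (∑ j, ⌈B.repr s j⌉ • (b j : V))) :
      CDual V → ℂ) : FGerm V) * T := by
    rw [← hFe]
    linear_combination (-F) * hT
  rw [genM, hS, hF2, ← mul_assoc, ← Filter.Germ.coe_mul]
  congr 2
  funext ξ
  rw [Pi.mul_apply, ← Complex.exp_add]
  congr 1
  have hy : ∑ j, Int.fract ((-B.coord j) s) • B j = -s + ∑ j, ⌈B.repr s j⌉ • (b j : V) := by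
    have h1 : ∀ j, Int.fract ((-B.coord j) s) • B j =
        ⌈B.repr s j⌉ • (b j : V) - B.repr s j • B j := by
      intro j
      rw [LinearMap.neg_apply, Module.Basis.coord_apply, ← hBb, ← Int.cast_smul_eq_zsmul ℝ,
        ← sub_smul, Int.fract, Int.floor_neg]
      push_cast
      congr 1
      ring
    rw [Finset.sum_congr rfl fun j _ => h1 j, Finset.sum_sub_distrib, B.sum_repr]
    abel
  rw [hy, map_add, map_neg]

end Unimodular

/-! ### Components of products with exponentials -/

section Components

variable {V : Type*} [NormedAddCommGroup V] [NormedSpace ℝ V]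

/-- The germ of `⟨ξ,x⟩^r / r!`. -/
def expTerm (x : V) (r : ℕ) : FGerm V :=
  ((fun ξ => ξ x ^ r / (r.factorial : ℂ) : CDual V → ℂ) : FGerm V)

/-- The homogeneous components of `e^⟨ξ,x⟩ F`, if `F` has no components of degree less than `-d`. -/
theorem homComp_exp_mul {F : FGerm V} {a : ℤ → CDual V → ℂ} (h : HasExpansion F a) {d : ℕ}
    (hd : ∀ᶠ ξ in nearZero V, ∀ n < -(d : ℤ), a n ξ = 0) (x : V) (m : ℤ) :
    homComp (((fun ξ => Complex.exp (ξ x) : CDual V → ℂ) : FGerm V) * F) m =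
      ∑ r ∈ Finset.range (m + d + 1).toNat, expTerm x r * (a (m - r) : FGerm V) := by
  rw [(h.exp_mul hd x).homComp_eq m]
  have := map_sum (Filter.Germ.coeRingHom (R := ℂ) (nearZero V))
    (fun r : ℕ => ((fun ξ => ξ x ^ r / (r.factorial : ℂ) : CDual V → ℂ) * a (m - r)))
    (Finset.range (m + d + 1).toNat)
  refine Eq.trans (congrArg _ (funext fun ξ => ?_)) this
  rw [Finset.sum_apply]
  rfl

/-- Expansion of `⟨ξ,x⟩^r / r!` when `x = ∑ t_j b_j`. -/
theorem expTerm_sum {ι : Type*} [Fintype ι] (b : ι → V) (t : ι → ℝ) (r : ℕ) :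
    expTerm (∑ j, t j • b j) r = ∑ J : Fin r → ι, (∏ i, t (J i)) •
      ((fun ξ => (r.factorial : ℂ)⁻¹ * ∏ i, ξ (b (J i)) : CDual V → ℂ) : FGerm V) := by
  classical
  have := map_sum (Filter.Germ.coeRingHom (R := ℂ) (nearZero V))
    (fun J : Fin r → ι => (∏ i, t (J i)) •
      (fun ξ => (r.factorial : ℂ)⁻¹ * ∏ i, ξ (b (J i)) : CDual V → ℂ)) Finset.univ
  rw [expTerm]
  refine Eq.trans (congrArg _ (funext fun ξ => ?_)) this
  rw [Finset.sum_apply, map_sum, Fintype.sum_pow, Finset.sum_div]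
  refine Finset.sum_congr rfl fun J _ => ?_
  simp only [map_smul, Complex.real_smul, Finset.prod_mul_distrib, Pi.smul_apply,
    Complex.ofReal_prod]
  ring

theorem mul_mem_homPolyDual {r k : ℕ} (z : ℂ) (x : Fin r → V) {P : CDual V → ℂ}
    (hP : P ∈ homPolyDual V k) :
    (fun ξ : CDual V => z * (∏ i, ξ (x i)) * P ξ) ∈ homPolyDual V (r + k) := by
  induction hP using Submodule.span_induction with
  | mem P hP =>
    obtain ⟨y, rfl⟩ := hP
    have h : (fun ξ : CDual V => z * (∏ i, ξ (x i)) * ∏ i, ξ (y i)) =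
        z • fun ξ : CDual V => ∏ i, ξ ((Fin.append x y) i) := by
      funext ξ
      simp only [Pi.smul_apply, smul_eq_mul, Fin.prod_univ_add, Fin.append_left, Fin.append_right,
        mul_assoc]
    rw [h]
    exact Submodule.smul_mem _ _ (Submodule.subset_span ⟨_, rfl⟩)
  | zero =>
    simp only [Pi.zero_apply, mul_zero]
    exact Submodule.zero_mem _
  | add f g _ _ hf hg =>
    simp only [Pi.add_apply, mul_add]
    exact Submodule.add_mem _ hf hg
  | smul c f _ hf =>
    have h : (fun ξ : CDual V => z * (∏ i, ξ (x i)) * (c • f) ξ) =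
        c • fun ξ : CDual V => z * (∏ i, ξ (x i)) * f ξ := by
      funext ξ
      simp only [Pi.smul_apply, smul_eq_mul]
      ring
    rw [h]
    exact Submodule.smul_mem _ _ hf

theorem mul_mem_homRat {r : ℕ} {m : ℤ} (z : ℂ) (x : Fin r → V) {G : FGerm V}
    (hG : G ∈ HomRat V (m - r)) :
    ((fun ξ => z * ∏ i, ξ (x i) : CDual V → ℂ) : FGerm V) * G ∈ HomRat V m := by
  obtain ⟨N, k, w, P, hk, hw, hP, rfl⟩ := hG
  refine ⟨N, r + k, w, _, by push_cast; omega, hw, mul_mem_homPolyDual z x hP, ?_⟩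
  rw [← Filter.Germ.coe_mul]
  congr 1
  funext ξ
  simp only [Pi.mul_apply]
  ring

theorem smul_mem_tensorFun {A : Submodule ℝ (V → ℝ)} {R : Set (FGerm V)} {f : V → ℝ}
    (hf : f ∈ A) {g : FGerm V} (hg : g ∈ R) : (fun s => f s • g) ∈ tensorFun A R :=
  Submodule.subset_span ⟨f, hf, g, hg, rfl⟩

/-- The products of `⟨ξ,y⟩^r / r!` with a homogeneous rational function, where `y` is a combination
of the vectors `b j` whose coefficients are step functions of `s`. -/
theorem expTerm_mul_mem_tensorFun_stepPoly {ι : Type*} [Fintype ι] (b : ι → V)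
    {η : ι → Module.Dual ℝ V} {Ψ : Set (Module.Dual ℝ V)} (hη : ∀ j, η j ∈ Ψ) {r : ℕ} {k m : ℤ}
    (hr : (r : ℤ) ≤ k) {G : FGerm V} (hG : G ∈ HomRat V (m - r)) :
    (fun s : V => expTerm (∑ j, Int.fract (η j s) • b j) r * G) ∈
      tensorFun (stepPoly Ψ k) (HomRat V m) := by
  have h : (fun s : V => expTerm (∑ j, Int.fract (η j s) • b j) r * G) =
      ∑ J : Fin r → ι, fun s : V => (∏ i, Int.fract (η (J i) s)) •
        (((fun ξ => (r.factorial : ℂ)⁻¹ * ∏ i, ξ (b (J i)) : CDual V → ℂ) : FGerm V) * G) := by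
    funext s
    rw [expTerm_sum, Finset.sum_apply, Finset.sum_mul]
    exact Finset.sum_congr rfl fun J _ => germ_smul_mul _ _ _
  rw [h]
  refine Submodule.sum_mem _ fun J _ => ?_
  have hf : (fun s => ∏ i, Int.fract (η (J i) s)) ∈ stepPoly Ψ k :=
    Submodule.subset_span ⟨r, fun i => η (J i), hr, fun i => hη _, rfl⟩
  exact smul_mem_tensorFun hf (mul_mem_homRat _ _ hG)

theorem expTerm_mul_mem_tensorFun_quasiPoly [FiniteDimensional ℝ V] {Ψ : Set (Module.Dual ℝ V)}
    {r : ℕ} {k q m : ℤ} (hr : k + r ≤ q) {F : V → FGerm V}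
    (hF : F ∈ tensorFun (stepPoly Ψ k) (HomRat V (m - r))) :
    (fun s : V => expTerm s r * F s) ∈ tensorFun (quasiPoly Ψ q) (HomRat V m) := by
  induction hF using Submodule.span_induction with
  | mem F hF =>
    obtain ⟨f, hf, G, hG, rfl⟩ := hF
    set b := Module.finBasis ℝ V
    have h : (fun s : V => expTerm s r * (f s • G)) =
        ∑ J : Fin r → Fin (Module.finrank ℝ V), fun s : V =>
          (f * fun s => ∏ i, b.coord (J i) s) s •
          (((fun ξ => (r.factorial : ℂ)⁻¹ * ∏ i, ξ (b (J i)) : CDual V → ℂ) : FGerm V) * G) := by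
      funext s
      conv_lhs => rw [← b.sum_repr s]
      rw [expTerm_sum, Finset.sum_apply, Finset.sum_mul, b.sum_repr]
      refine Finset.sum_congr rfl fun J _ => ?_
      rw [germ_mul_smul, germ_smul_mul, smul_smul]
      rfl
    rw [h]
    refine Submodule.sum_mem _ fun J _ => ?_
    have hp : (fun s => ∏ i, b.coord (J i) s) ∈ homPoly V r :=
      Submodule.subset_span ⟨fun i => b.coord (J i), rfl⟩
    have hfp : (f * fun s => ∏ i, b.coord (J i) s) ∈ quasiPoly Ψ q :=
      Submodule.subset_span ⟨k, r, hr, f, hf, _, hp, rfl⟩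
    exact smul_mem_tensorFun hfp (mul_mem_homRat _ _ hG)
  | zero =>
    simp only [Pi.zero_apply, mul_zero]
    exact Submodule.zero_mem _
  | add F G _ _ hF hG =>
    simp only [Pi.add_apply, mul_add]
    exact Submodule.add_mem _ hF hG
  | smul c F _ hF =>
    have h : (fun s : V => expTerm s r * (c • F) s) = c • fun s : V => expTerm s r * F s := by
      funext s
      simp only [Pi.smul_apply]
      exact germ_mul_smul _ _ _
    rw [h]
    exact Submodule.smul_mem _ _ hF

end Components

/-! ### Decompositions into unimodular cones -/

section Decomposition

variable {V : Type*} [NormedAddCommGroup V] [NormedSpace ℝ V] (Λ : Submodule ℤ V)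

/-- The restriction to the lattice of a function on `V`, shifted by `s`. -/
def latticeShift (s : V) : (V → ℝ) →ₗ[ℝ] (V → ℂ) where
  toFun f := (Λ : Set V).indicator fun x => (f (x - s) : ℂ)
  map_add' f g := by
    funext x
    by_cases hx : x ∈ Λ <;> simp [hx]
  map_smul' r f := by
    funext x
    by_cases hx : x ∈ Λ <;> simp [hx]

theorem latticeShift_coneIndicator (s : V) (c : PointedCone ℝ V) :
    latticeShift Λ s (coneIndicator c) = latticeIndicator Λ (s +ᵥ (c : Set V)) := by
  classical
  funext x
  simp only [latticeShift, latticeIndicator, coneIndicator, LinearMap.coe_mk, AddHom.coe_mk,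
    Set.indicator_apply, Set.mem_ofPred_eq, mem_vadd_iff_sub_mem, SetLike.mem_coe]
  by_cases h1 : x ∈ Λ <;> by_cases h2 : x - s ∈ c <;> simp [h1, h2]

variable [FiniteDimensional ℝ V] [MeasurableSpace V] [BorelSpace V] [DiscreteTopology Λ]
  [IsZLattice ℝ Λ]

theorem hasGen_latticeShift_of_mem_span (s : V) {f : V → ℝ}
    (hf : f ∈ Submodule.span ℝ {f : V → ℝ | ∃ c' : PointedCone ℝ V, IsRationalCone Λ c' ∧
      ContainsLine (c' : Set V) ∧ f = coneIndicator c'}) :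
    HasGen (latticeShift Λ s f) 0 := by
  induction hf using Submodule.span_induction with
  | mem f hf =>
    obtain ⟨c', hc', ⟨x, v, hv, hline⟩, rfl⟩ := hf
    have h := hasGen_genS Λ hc' s
    have hl : ContainsLine (s +ᵥ (c' : Set V)) := ⟨s + x, v, hv, fun t => by
      rw [mem_vadd_iff_sub_mem, add_assoc, add_sub_cancel_left]
      exact hline t⟩
    rw [genS, if_pos hl] at h
    rwa [latticeShift_coneIndicator]
  | zero =>
    rw [map_zero]
    exact HasGen.zero
  | add f g _ _ hf hg =>
    rw [map_add, ← add_zero (0 : FGerm V)]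
    exact hf.add hg
  | smul r f _ hf =>
    have h := hf.smul r
    rwa [smul_zero, Complex.coe_smul, ← map_smul] at h

variable {Λ}

/-- The generating functions of shifted cones are additive with respect to decompositions modulo
indicator functions of cones with lines. -/
theorem genS_eq_sum {c : PointedCone ℝ V} (hc : IsRationalCone Λ c)
    (D : UnimodularDecomposition Λ c) (s : V) :
    genS Λ (s +ᵥ (c : Set V)) = ∑ u, ((D.sign u : ℤ) : ℝ) •
      genS Λ (s +ᵥ (unimodularCone (D.basis u) : Set V)) := by
  have h1 := hasGen_latticeShift_of_mem_span Λ s D.congr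
  have h2 : HasGen (∑ u, (((D.sign u : ℤ) : ℝ) : ℂ) •
      latticeIndicator Λ (s +ᵥ (unimodularCone (D.basis u) : Set V)))
      (∑ u, ((D.sign u : ℤ) : ℝ) • genS Λ (s +ᵥ (unimodularCone (D.basis u) : Set V))) :=
    HasGen.sum _ fun u _ => (hasGen_genS Λ (isRationalCone_unimodularCone _) s).smul _
  refine (hasGen_genS Λ hc s).unique ?_
  have h3 := h1.add h2
  rw [zero_add] at h3
  convert h3 using 1
  rw [map_sub, map_sum, latticeShift_coneIndicator]
  simp only [map_smul, latticeShift_coneIndicator, Complex.coe_smul]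
  rw [sub_add_cancel]

theorem genM_eq_sum {c : PointedCone ℝ V} (hc : IsRationalCone Λ c)
    (D : UnimodularDecomposition Λ c) (s : V) :
    genM Λ s c = ∑ u, ((D.sign u : ℤ) : ℝ) • genM Λ s (unimodularCone (D.basis u)) := by
  rw [genM, genS_eq_sum hc D s, Finset.mul_sum]
  exact Finset.sum_congr rfl fun u _ => germ_mul_smul _ _ _

/-- The components of `M(s,u)`, for a unimodular cone `u`, are step-polynomials in `s`. -/
theorem homComp_genM_unimodularCone_mem
    (b : Module.Basis (Fin (Module.finrank ℝ V)) ℤ Λ) {Ψ : Set (Module.Dual ℝ V)}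
    (hΨ : ∀ j, -(b.ofZLatticeBasis ℝ Λ).coord j ∈ Ψ) :
    ∃ A : V → ℤ → CDual V → ℂ, (∀ s, HasExpansion (genM Λ s (unimodularCone b)) (A s)) ∧
      ∀ m, (fun s => (A s m : FGerm V)) ∈
        tensorFun (stepPoly Ψ (m + Module.finrank ℝ V)) (HomRat V m) := by
  have hb0 : ∀ j, (b j : V) ≠ 0 := fun j h => b.ne_zero j (Subtype.ext h)
  obtain ⟨T, a, hT, ha, ha0, haR⟩ := exists_todd_germ (fun j => (b j : V)) hb0
  have hev : ∀ᶠ ξ in nearZero V, ∀ n < -(Module.finrank ℝ V : ℤ), a n ξ = 0 :=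
    Filter.Eventually.of_forall fun ξ n hn => by rw [ha0 n hn, Pi.zero_apply]
  have hE : ∀ s, HasExpansion (genM Λ s (unimodularCone b)) _ := fun s => by
    rw [genM_unimodularCone b hT s]
    exact ha.exp_mul hev _
  refine ⟨_, hE, fun m => ?_⟩
  have h2 : (fun s => homComp (genM Λ s (unimodularCone b)) m) ∈
      tensorFun (stepPoly Ψ (m + Module.finrank ℝ V)) (HomRat V m) := by
    have h3 := Submodule.sum_mem
      (tensorFun (stepPoly Ψ (m + Module.finrank ℝ V)) (HomRat V m))
      (t := Finset.range (m + Module.finrank ℝ V + 1).toNat)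
      (f := fun r s => expTerm (∑ j, Int.fract ((-(b.ofZLatticeBasis ℝ Λ).coord j) s) •
        b.ofZLatticeBasis ℝ Λ j) r * (a (m - r) : FGerm V)) fun r hr => by
        rw [Finset.mem_range] at hr
        exact expTerm_mul_mem_tensorFun_stepPoly _ hΨ (by omega) (haR _ (by omega))
    convert h3 using 1
    funext s
    rw [Finset.sum_apply, genM_unimodularCone b hT s]
    exact homComp_exp_mul ha hev _ m
  simpa only [(hE _).homComp_eq m] using h2

/-- The components of `M(s,c)` are step-polynomials in `s`. -/
theorem homComp_genM_mem {c : PointedCone ℝ V} (hc : IsRationalCone Λ c)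
    (D : UnimodularDecomposition Λ c) (m : ℤ) :
    (fun s : V => homComp (genM Λ s c) m) ∈
      tensorFun (stepPoly D.Psi (m + Module.finrank ℝ V)) (HomRat V m) := by
  have h := fun u => homComp_genM_unimodularCone_mem (D.basis u) (Ψ := D.Psi)
    fun j => ⟨u, j, rfl⟩
  choose A hA hAm using h
  have h1 : (fun s : V => homComp (genM Λ s c) m) =
      ∑ u, ((D.sign u : ℤ) : ℝ) • fun s : V => (A u s m : FGerm V) := by
    funext s
    rw [genM_eq_sum hc D s,
      (HasExpansion.sum Finset.univ fun u _ => (hA u s).smul ((D.sign u : ℤ) : ℝ)).homComp_eq m,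
      Finset.sum_apply, Finset.sum_apply]
    exact map_sum (Filter.Germ.coeRingHom (R := ℂ) (nearZero V)) _ _
  rw [h1]
  exact Submodule.sum_mem _ fun u _ => Submodule.smul_mem _ _ (hAm u m)

/-! ### Comparison of `M` and `S` -/

/-- Both `S(s + c)` and `M(s,c)` have expansions starting in degree `-d` with the term `I(c)`, and
`S(s + c) = e^⟨ξ,s⟩ M(s,c)`. -/
theorem homComp_genS_genM {c : PointedCone ℝ V} (hc : IsRationalCone Λ c) (hfull : IsFullDim c)
    (s : V) :
    (∀ m : ℤ, m < -(Module.finrank ℝ V : ℤ) →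
      homComp (genS Λ (s +ᵥ (c : Set V))) m = 0 ∧ homComp (genM Λ s c) m = 0) ∧
    homComp (genS Λ (s +ᵥ (c : Set V))) (-(Module.finrank ℝ V : ℤ)) = genI Λ (c : Set V) ∧
    homComp (genM Λ s c) (-(Module.finrank ℝ V : ℤ)) = genI Λ (c : Set V) ∧
    ∀ m : ℤ, homComp (genS Λ (s +ᵥ (c : Set V))) m =
      ∑ r ∈ Finset.range (m + Module.finrank ℝ V + 1).toNat,
        expTerm s r * homComp (genM Λ s c) (m - r) := by
  obtain ⟨a, ha, ha0, haI⟩ := exists_hasExpansion_genS Λ hc hfull s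
  have hMe : genM Λ s c = ((fun ξ => Complex.exp (ξ (-s)) : CDual V → ℂ) : FGerm V) *
      genS Λ (s +ᵥ (c : Set V)) := by
    rw [genM]
    simp only [map_neg]
  obtain ⟨A, hM, hM0⟩ : ∃ A, HasExpansion (genM Λ s c) A ∧
      ∀ᶠ ξ in nearZero V, ∀ m < -(Module.finrank ℝ V : ℤ), A m ξ = 0 := by
    refine ⟨_, hMe ▸ ha.exp_mul ha0 (-s), Filter.Eventually.of_forall fun ξ m hm => ?_⟩
    rw [show (m + Module.finrank ℝ V + 1).toNat = 0 by omega, Finset.range_zero, Finset.sum_empty]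
  have hSe : genS Λ (s +ᵥ (c : Set V)) =
      ((fun ξ => Complex.exp (ξ s) : CDual V → ℂ) : FGerm V) * genM Λ s c := by
    rw [hMe, ← mul_assoc, ← Filter.Germ.coe_mul]
    have : ((fun ξ => Complex.exp (ξ s) : CDual V → ℂ) * fun ξ => Complex.exp (ξ (-s))) = 1 := by
      funext ξ
      rw [Pi.mul_apply, ← Complex.exp_add, ← map_add, add_neg_cancel, map_zero, Complex.exp_zero,
        Pi.one_apply]
    rw [this, Filter.Germ.coe_one, one_mul]
  refine ⟨fun m hm => ⟨?_, ?_⟩, ?_, ?_, fun m => ?_⟩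
  · rw [ha.homComp_eq]
    refine Filter.Germ.coe_eq.mpr ?_
    filter_upwards [ha0] with ξ hξ using hξ m hm
  · rw [hM.homComp_eq]
    refine Filter.Germ.coe_eq.mpr ?_
    filter_upwards [hM0] with ξ hξ using hξ m hm
  · rw [ha.homComp_eq, haI]
  · rw [hMe, homComp_exp_mul ha ha0, neg_add_cancel, zero_add, Int.toNat_one, Finset.sum_range_one,
      Nat.cast_zero, sub_zero, haI]
    rw [show expTerm (-s) 0 = 1 from congrArg _ (funext fun ξ => by simp), one_mul]
  · conv_lhs => rw [hSe]
    rw [homComp_exp_mul hM hM0]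
    exact Finset.sum_congr rfl fun r _ => by rw [hM.homComp_eq]

end Decomposition

end ConeSums

end

theorem mainTheorem4 {V : Type*} [NormedAddCommGroup V] [NormedSpace ℝ V] [FiniteDimensional ℝ V]
    [MeasurableSpace V] [BorelSpace V] (Λ : Submodule ℤ V) [DiscreteTopology Λ] [IsZLattice ℝ Λ]
    (c : PointedCone ℝ V) (hc : IsRationalCone Λ c) (hfull : IsFullDim c) :
    -- (i) and the first part of (ii), for every unimodular decomposition of `[c]`
    (∀ (D : UnimodularDecomposition Λ c) (m : ℤ),
      (fun s : V => homComp (genM Λ s c) m) ∈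
          tensorFun (stepPoly D.Psi (m + Module.finrank ℝ V)) (HomRat V m) ∧
        (fun s : V => homComp (genS Λ (s +ᵥ (c : Set V))) m) ∈
          tensorFun (quasiPoly D.Psi (m + Module.finrank ℝ V)) (HomRat V m)) ∧
    -- the explicit formula in (ii)
    (∀ (m : ℤ) (s : V),
      homComp (genS Λ (s +ᵥ (c : Set V))) m =
        ∑ r ∈ Finset.range (m + Module.finrank ℝ V + 1).toNat,
          ((fun ξ => (ξ s) ^ r / (r.factorial : ℂ) : CDual V → ℂ) : FGerm V) *
            homComp (genM Λ s c) (m - r)) ∧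
    -- (iii) the component of lowest degree
    (∀ s : V,
      (∀ m : ℤ, m < -(Module.finrank ℝ V : ℤ) →
        homComp (genS Λ (s +ᵥ (c : Set V))) m = 0 ∧ homComp (genM Λ s c) m = 0) ∧
      homComp (genS Λ (s +ᵥ (c : Set V))) (-(Module.finrank ℝ V : ℤ)) = genI Λ (c : Set V) ∧
      homComp (genM Λ s c) (-(Module.finrank ℝ V : ℤ)) = genI Λ (c : Set V)) ∧
    (¬ ContainsLine (c : Set V) → genI Λ (c : Set V) ≠ 0) := by
  have hkey := homComp_genS_genM hc hfull
  refine ⟨fun D m => ⟨homComp_genM_mem hc D m, ?_⟩, fun m s => (hkey s).2.2.2 m,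
    fun s => ⟨(hkey s).1, (hkey s).2.1, (hkey s).2.2.1⟩, genI_ne_zero Λ hc hfull⟩
  have h := Submodule.sum_mem
    (tensorFun (quasiPoly D.Psi (m + Module.finrank ℝ V)) (HomRat V m))
    (t := Finset.range (m + Module.finrank ℝ V + 1).toNat)
    (f := fun r s => expTerm s r * homComp (genM Λ s c) (m - r)) fun r _ =>
      expTerm_mul_mem_tensorFun_quasiPoly (by omega) (homComp_genM_mem hc D (m - r))
  convert h using 1
  funext s
  rw [(hkey s).2.2.2 m, Finset.sum_apply]
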